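/- Let $\alpha=\{\alpha_k\}_{k\in\mathbb Z}$ be a sequence of complex numbers in the open unit disk $\mathbb D$, put $\rho_k=\sqrt{1-|\alpha_k|^2}$ and $\theta_k=\begin{pmatrix}-\alpha_k&\rho_k\\ \rho_k&\overline{\alpha_k}\end{pmatrix}$. Let $V$ and $W$ be the operators on $\ell^2(\mathbb Z)$ that are block diagonal in the standard basis $\{\delta_k\}_{k\in\mathbb Z}$, where $V$ has the block $\theta_{2m}$ on the coordinates $2m-1,2m$ and $W$ has the block $\theta_{2m+1}$ on the coordinates $2m,2m+1$, $m\in\mathbb Z$, and let $U=VW$ be the CMV operator. The scalar product $(\cdot,\cdot)$ of $\ell^2(\mathbb Z)$ is linear in the second argument, $\mu_0$ is the normalized Lebesgue measure $d\theta/(2\pi)$ on $\partial\mathbb D$, and $\ln$ is the principal branch of the logarithm. For $k\in\mathbb Z$ put $$M_{1,1}(z,k)=(\delta_k,(U+zI)(U-zI)^{-1}\delta_k),\quad z\in\mathbb D,\qquad M_j(U,k)=2(\delta_k,(U^*)^j\delta_k),\quad j\in\mathbb N,$$ $$L_1(U,k)=M_1(U,k),\qquad L_j(U,k)=M_j(U,k)-\sum_{\ell=1}^{j-1}\frac{\ell}{j}\,M_{j-\ell}(U,k)L_\ell(U,k),\quad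 j\ge 2,$$ $$\Xi_{1,1}(\zeta,k)=\lim_{r\uparrow1}\operatorname{Im}\bigl(\ln M_{1,1}(r\zeta,k)\bigr),\quad \zeta\in\partial\mathbb D.$$ **Theorem.** Let $k\in\mathbb Z$. For $z\in\mathbb D$ the operator $U-zI$ is invertible and $\operatorname{Re}M_{1,1}(z,k)>0$. The $L_j(U,k)$ are the Taylor coefficients of $\ln M_{1,1}(\cdot,k)$ at $0$: $\ln M_{1,1}(z,k)=\sum_{j=1}^\infty L_j(U,k)z^j$ for $|z|$ sufficiently small. The limit $\Xi_{1,1}(\zeta,k)$ exists for $\mu_0$-a.e. $\zeta$, it satisfies $-\pi/2\le\Xi_{1,1}(\zeta,k)\le\pi/2$ for $\mu_0$-a.e. $\zeta$, the function $\Xi_{1,1}(\cdot,k)$ is $\mu_0$-integrable, and $$\ln M_{1,1}(z,k)=i\oint_{\partial\mathbb D}d\mu_0(\zeta)\,\Xi_{1,1}(\zeta,k)\,\frac{\zeta+z}{\zeta-z},\quad z\in\mathbb D.$$ Moreover, the following trace formulas hold: $$L_j(U,k)=2i\oint_{\partial\mathbb D}d\mu_0(\zeta)\,\Xi_{1,1}(\zeta,k)\,\overline{\zeta}^{\,j},\quad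 j\in\mathbb N.$$ In particular, $$L_1(U,k)=-2\alpha_k\overline{\alpha_{k+1}}=2i\oint_{\partial\mathbb D}d\mu_0(\zeta)\,\Xi_{1,1}(\zeta,k)\,\overline{\zeta}.$$ -/

import Mathlib

open MeasureTheory Filter Topology
open scoped ComplexConjugate

noncomputable section

namespace CMV

/-- The Hilbert space `ℓ²(ℤ)` of square summable complex sequences; the scalar product
`inner ℂ u v` is linear in the second argument. -/
abbrev SeqSpace : Type := lp (fun _ : ℤ => ℂ) 2

/-- The standard basis vector with entry `1` at `k` and `0` elsewhere. -/
def delta (k : ℤ) : SeqSpace := lp.single 2 k (1 : ℂ)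

/-- `ρ_k = √(1 - |α_k|²)`. -/
def rho (α : ℤ → Complex.UnitDisc) (k : ℤ) : ℝ := Real.sqrt (1 - ‖(α k : ℂ)‖ ^ 2)

/-- The unitary `2 × 2` matrix `θ_k`. -/
def theta (α : ℤ → Complex.UnitDisc) (k : ℤ) : Matrix (Fin 2) (Fin 2) ℂ :=
  !![-(α k : ℂ), (rho α k : ℂ); (rho α k : ℂ), conj (α k : ℂ)]

lemma norm_theta_le (α : ℤ → Complex.UnitDisc) (k : ℤ) (i j : Fin 2) :
    ‖theta α k i j‖ ≤ 1 := by
  have h := (α k).norm_lt_one.le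
  have hr : ‖(rho α k : ℂ)‖ ≤ 1 := by
    rw [Complex.norm_real, Real.norm_eq_abs, rho, abs_of_nonneg (Real.sqrt_nonneg _)]
    exact Real.sqrt_le_one.2 (by nlinarith [sq_nonneg ‖(α k : ℂ)‖])
  fin_cases i <;> fin_cases j <;> simp [theta] <;> first | exact h | simpa using hr

lemma exists_weighted_shift (a : ℤ → ℂ) (ha : ∀ n, ‖a n‖ ≤ 1) (s : ℤ) (u : SeqSpace) :
    ∃ v : SeqSpace, (∀ n, v n = a n * u (n + s)) ∧ ‖v‖ ≤ ‖u‖ := by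
  have hp : 0 < (2 : ENNReal).toReal := by norm_num
  have hb : ∀ t : Finset ℤ, ∑ n ∈ t, ‖a n * u (n + s)‖ ^ (2 : ENNReal).toReal
      ≤ ‖u‖ ^ (2 : ENNReal).toReal := by
    intro t
    calc ∑ n ∈ t, ‖a n * u (n + s)‖ ^ (2 : ENNReal).toReal
        ≤ ∑ n ∈ t, ‖u (n + s)‖ ^ (2 : ENNReal).toReal := by
          refine Finset.sum_le_sum fun n _ => ?_
          refine Real.rpow_le_rpow (norm_nonneg _) ?_ hp.le
          rw [norm_mul]
          exact mul_le_of_le_one_left (norm_nonneg _) (ha n)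
      _ = ∑ m ∈ t.map (addRightEmbedding s), ‖u m‖ ^ (2 : ENNReal).toReal := by
          simp
      _ ≤ _ := lp.sum_rpow_le_norm_rpow hp u _
  exact ⟨⟨fun n => a n * u (n + s), memℓp_gen' hb⟩, fun _ => rfl,
    lp.norm_le_of_forall_sum_le hp (norm_nonneg _) hb⟩

/-- The action on sequences of the block diagonal matrix with the blocks `θ_m`, `p m`, the block
`θ_m` acting on the coordinates `m - 1` and `m`. It is used for `p` the even or the odd integers,
so that every coordinate belongs to exactly one block: `n` is the second coordinate of the block
`θ_n` if `p n`, and the first coordinate of the block `θ_{n+1}` otherwise. -/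
def blockFun (α : ℤ → Complex.UnitDisc) (p : ℤ → Prop) [DecidablePred p] (u : ℤ → ℂ) (n : ℤ) : ℂ :=
  if p n then theta α n 1 0 * u (n - 1) + theta α n 1 1 * u n
  else theta α (n + 1) 0 0 * u n + theta α (n + 1) 0 1 * u (n + 1)

lemma exists_blockFun (α : ℤ → Complex.UnitDisc) (p : ℤ → Prop) [DecidablePred p] (u : SeqSpace) :
    ∃ v : SeqSpace, (∀ n, v n = blockFun α p u n) ∧ ‖v‖ ≤ 3 * ‖u‖ := by
  obtain ⟨v₁, h₁, b₁⟩ := exists_weighted_shift (fun n => if p n then theta α n 1 0 else 0)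
    (fun n => by split_ifs <;> simp [norm_theta_le]) (-1) u
  obtain ⟨v₂, h₂, b₂⟩ := exists_weighted_shift
    (fun n => if p n then theta α n 1 1 else theta α (n + 1) 0 0)
    (fun n => by split_ifs <;> simp [norm_theta_le]) 0 u
  obtain ⟨v₃, h₃, b₃⟩ := exists_weighted_shift (fun n => if p n then 0 else theta α (n + 1) 0 1)
    (fun n => by split_ifs <;> simp [norm_theta_le]) 1 u
  refine ⟨v₁ + v₂ + v₃, fun n => ?_, ?_⟩
  · rw [lp.coeFn_add, lp.coeFn_add, Pi.add_apply, Pi.add_apply, h₁, h₂, h₃, blockFun]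
    split_ifs <;> simp [sub_eq_add_neg]
  · have := norm_add_le (v₁ + v₂) v₃
    have := norm_add_le v₁ v₂
    linarith

lemma memℓp_blockFun (α : ℤ → Complex.UnitDisc) (p : ℤ → Prop) [DecidablePred p] (u : SeqSpace) :
    Memℓp (blockFun α p u) 2 := by
  obtain ⟨v, hv, -⟩ := exists_blockFun α p u
  have : blockFun α p u = v := funext fun n => (hv n).symm
  rw [this]
  exact lp.memℓp v

/-- The block diagonal matrix of `blockFun` as a bounded operator on `ℓ²(ℤ)`. -/
def blockOp (α : ℤ → Complex.UnitDisc) (p : ℤ → Prop) [DecidablePred p] : SeqSpace →L[ℂ] SeqSpace :=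
  LinearMap.mkContinuous
    { toFun := fun u => ⟨blockFun α p u, memℓp_blockFun α p u⟩
      map_add' := fun u v => by
        ext n
        simp only [lp.coeFn_add, Pi.add_apply, blockFun]
        split_ifs <;> ring
      map_smul' := fun c u => by
        ext n
        simp only [lp.coeFn_smul, Pi.smul_apply, smul_eq_mul, RingHom.id_apply, blockFun]
        split_ifs <;> ring }
    3
    (fun u => by
      obtain ⟨v, hv, hb⟩ := exists_blockFun α p u
      refine le_of_eq_of_le (congrArg norm (lp.ext (funext fun n => ?_))) hb
      exact (hv n).symm)

/-- `V`, with the blocks `θ_{2k}` on the coordinates `2k - 1, 2k`. -/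
def opV (α : ℤ → Complex.UnitDisc) : SeqSpace →L[ℂ] SeqSpace := blockOp α Even

/-- `W`, with the blocks `θ_{2k+1}` on the coordinates `2k, 2k + 1`. -/
def opW (α : ℤ → Complex.UnitDisc) : SeqSpace →L[ℂ] SeqSpace := blockOp α Odd

/-- The CMV operator `U = V W` on `ℓ²(ℤ)`. -/
def opU (α : ℤ → Complex.UnitDisc) : SeqSpace →L[ℂ] SeqSpace := opV α * opW α

/-- `M_{1,1}(z,k) = (δ_k, (U + zI)(U - zI)⁻¹ δ_k)`. -/
def M11 (α : ℤ → Complex.UnitDisc) (k : ℤ) (z : ℂ) : ℂ :=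
  inner ℂ (delta k) (((opU α + z • 1) * Ring.inverse (opU α - z • 1)) (delta k))

/-- `M_j(U,k) = 2 (δ_k, (U*)^j δ_k)`. -/
def Mcoeff (α : ℤ → Complex.UnitDisc) (k : ℤ) (j : ℕ) : ℂ :=
  2 * inner ℂ (delta k) ((ContinuousLinearMap.adjoint (opU α) ^ j) (delta k))

/-- The recursion `d_1 = c_1`, `d_j = c_j - ∑_{ℓ=1}^{j-1} (ℓ/j) c_{j-ℓ} d_ℓ` (written with
`j = n + 1` and `ℓ = l + 1`) for the Taylor coefficients `d_j` of the logarithm of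
`1 + ∑_{j ≥ 1} c_j z^j`. The value at `0` is the vanishing constant term. -/
def logCoeff (c : ℕ → ℂ) : ℕ → ℂ
  | 0 => 0
  | n + 1 => c (n + 1) -
      ∑ l : Fin n, (((l : ℕ) + 1 : ℂ) / (n + 1 : ℂ)) * c (n - (l : ℕ)) * logCoeff c ((l : ℕ) + 1)

/-- The coefficients `L_j(U,k)`, `j ≥ 1`. -/
def Lcoeff (α : ℤ → Complex.UnitDisc) (k : ℤ) (j : ℕ) : ℂ := logCoeff (Mcoeff α k) j

/-- The normalized Lebesgue measure `dθ/(2π)` on the unit circle, as a measure on `ℂ`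
concentrated on the unit circle. -/
def mu0 : Measure ℂ :=
  ENNReal.ofReal (2 * Real.pi)⁻¹ •
    (volume.restrict (Set.Ioc 0 (2 * Real.pi))).map (circleMap 0 1)

/-- `Im (ln M_{1,1}(z,k))`, with the principal branch of the logarithm. -/
def imLogM11 (α : ℤ → Complex.UnitDisc) (k : ℤ) (z : ℂ) : ℝ := (Complex.log (M11 α k z)).im

/-- `Ξ_{1,1}(ζ,k) = lim_{r ↑ 1} Im (ln M_{1,1}(rζ,k))`, for `|ζ| = 1`. -/
def Xi11 (α : ℤ → Complex.UnitDisc) (k : ℤ) (ζ : ℂ) : ℝ :=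
  limUnder (𝓝[<] (1 : ℝ)) fun r : ℝ => imLogM11 α k (r * ζ)

end CMV

end

/-!
For `|z| < 1` the function `log M₁₁` is holomorphic, vanishes at `0`, and has imaginary part
bounded by `π / 2`, because `U` is unitary and hence `Re M₁₁ > 0` (`re_M11_pos`). Its Taylor
coefficients are the `L_j`: those of `M₁₁` come from the geometric series of the resolvent
(`hasSum_M11`), and comparing coefficients in `(log M₁₁)' M₁₁ = M₁₁'` gives the recursion
(`hasSum_logCoeff`). Everything else holds for any power series `f(z) = ∑ d_n z ^ n` on the unit
disk with `d_0 = 0` and bounded imaginary part, with `d_n = L_n`.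

Radial limits of `Im f` exist almost everywhere by Fatou's theorem (`ae_exists_tendsto_im`). Since
`f(0)² = 0`, the real and the imaginary part of `f` have the same square integral over every
circle, so `∑ |d_n|²` is finite and the angular primitive `∑ (d_n / n) ζ ^ n` converges absolutely on
the closed disk. The real part `Φ` of its boundary values is Lipschitz, because its angular
derivative is `- Im f`, and so it is differentiable almost everywhere. At a point of
differentiability the radial limit of `Im f` is minus the derivative (`tendsto_im_of_hasDerivAt`):
`f(z)` is the integral of `Φ(ζ)` against the kernel `2x / (1 - x)²`, `x = z ζ̄`. After the subtraction
of a constant and a multiple of the sine, `|Φ|` is at most `ε |sin t| + C |1 - e^{it}|⁴`; the first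
term contributes at most `ε`, as the kernel changes sign together with the sine, and the second one
tends to `0`, as the imaginary part of the kernel has numerator `O(1 - r²)` and denominator
`|1 - x|⁴ ≥ |1 - e^{it}|⁴ / 16`.

By dominated convergence the limit `Ξ` satisfies `∫ Ξ ζ̄ ^ m = d_m / 2i`
(`integral_mul_conj_pow_of_tendsto`), which gives the trace formulas. Summation over `m` gives the
integral representation, since `(ζ + z) / (ζ - z) = 1 + 2 ∑_{m ≥ 1} (z ζ̄) ^ m` on the circle
(`tsum_eq_integral_herglotz`).
-/

namespace CMV

/-! ### The normalized Lebesgue measure on the circle -/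

instance isProbabilityMeasure_mu0 : IsProbabilityMeasure mu0 := by
  constructor
  have h : (0 : ℝ) ≤ (2 * Real.pi)⁻¹ := by positivity
  rw [mu0, Measure.smul_apply, Measure.map_apply (continuous_circleMap 0 1).measurable
    MeasurableSet.univ, Set.preimage_univ, Measure.restrict_apply MeasurableSet.univ,
    Set.univ_inter, Real.volume_Ioc, smul_eq_mul, ← ENNReal.ofReal_mul h, sub_zero,
    inv_mul_cancel₀ (by positivity), ENNReal.ofReal_one]

/-- Almost everywhere statements can be transferred from the angle to the circle without any
measurability assumption, because `circleMap 0 1` is injective on `(0, 2π]` and hence maps Borel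
null sets to Borel sets. -/
lemma ae_mu0_of_ae_circleMap {p : ℂ → Prop} (h : ∀ᵐ θ : ℝ, p (circleMap 0 1 θ)) :
    ∀ᵐ ζ ∂mu0, p ζ := by
  refine Measure.ae_smul_measure ?_ _
  have hinj : Set.InjOn (circleMap 0 1) (Set.Ioc 0 (2 * Real.pi)) := by
    have := injOn_circleMap_of_abs_sub_le (a := 0) (b := 2 * Real.pi) (R := 1) (c := 0)
      one_ne_zero (by simp [abs_of_pos Real.pi_pos])
    rwa [Set.uIoc_of_le Real.two_pi_pos.le] at this
  have hemb : MeasurableEmbedding ((Set.Ioc 0 (2 * Real.pi)).domRestrict (circleMap 0 1)) :=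
    (continuous_circleMap 0 1).continuousOn.measurableEmbedding measurableSet_Ioc hinj
  have hmap : (volume.restrict (Set.Ioc 0 (2 * Real.pi))).map (circleMap 0 1) =
      (volume.comap Subtype.val).map ((Set.Ioc 0 (2 * Real.pi)).domRestrict (circleMap 0 1)) := by
    rw [← map_comap_subtype_coe measurableSet_Ioc,
      Measure.map_map (continuous_circleMap 0 1).measurable measurable_subtype_coe]
    rfl
  rw [hmap, hemb.ae_map_iff]
  have := (ae_restrict_iff_subtype (μ := volume) (p := fun θ : ℝ => p (circleMap 0 1 θ))
    (measurableSet_Ioc (a := 0) (b := 2 * Real.pi))).1 (ae_restrict_of_ae h)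
  exact this

lemma ae_norm_eq_one : ∀ᵐ ζ ∂mu0, ‖ζ‖ = 1 :=
  ae_mu0_of_ae_circleMap (.of_forall fun θ => by simp)

lemma integral_mu0 {g : ℂ → ℂ} (hg : Continuous g) :
    ∫ ζ, g ζ ∂mu0 = (2 * Real.pi)⁻¹ * ∫ θ in (0 : ℝ)..2 * Real.pi, g (circleMap 0 1 θ) := by
  rw [mu0, integral_smul_measure, integral_map (continuous_circleMap 0 1).measurable.aemeasurable
    hg.aestronglyMeasurable, intervalIntegral.integral_of_le Real.two_pi_pos.le,
    ENNReal.toReal_ofReal (by positivity)]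
  simp

lemma integral_pow_mul_conj_pow (n m : ℕ) :
    ∫ ζ, ζ ^ n * conj ζ ^ m ∂mu0 = if n = m then 1 else 0 := by
  rw [integral_mu0 (by fun_prop)]
  have h : ∀ θ : ℝ, circleMap 0 1 θ ^ n * conj (circleMap 0 1 θ) ^ m =
      Complex.exp (((n : ℂ) - m) * Complex.I * θ) := by
    intro θ
    rw [circleMap_zero, Complex.ofReal_one, one_mul, ← Complex.exp_conj, ← Complex.exp_nat_mul,
      ← Complex.exp_nat_mul, ← Complex.exp_add]
    congr 1
    simp
    ring
  simp only [h]
  split_ifs with hnm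
  · subst hnm
    have : (Real.pi : ℂ) ≠ 0 := by exact_mod_cast Real.pi_ne_zero
    simp
    field_simp
  · have hc : ((n : ℂ) - m) * Complex.I ≠ 0 :=
      mul_ne_zero (sub_ne_zero.2 (by exact_mod_cast hnm)) Complex.I_ne_zero
    rw [integral_exp_mul_complex hc]
    have : Complex.exp (((n : ℂ) - m) * Complex.I * (2 * Real.pi : ℝ)) = 1 := by
      rw [Complex.exp_eq_one_iff]
      exact ⟨(n : ℤ) - m, by push_cast; ring⟩
    rw [this]
    simp

/-! ### Integrals of power series over the circle -/

lemma integrable_of_ae_norm_le {g : ℂ → ℂ} {C : ℝ} (hg : AEStronglyMeasurable g mu0)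
    (hC : ∀ᵐ ζ ∂mu0, ‖g ζ‖ ≤ C) : Integrable g mu0 :=
  (integrable_const C).mono' hg hC

lemma norm_conj_eq_one {ζ : ℂ} (h : ‖ζ‖ = 1) : ‖conj ζ‖ = 1 := by
  rw [Complex.norm_conj, h]

/-- Termwise integration of a series `∑ a_n e_n` with summable coefficients against a bounded
function. -/
lemma hasSum_integral_mul_tsum {g : ℂ → ℂ} {C : ℝ} (hg : AEStronglyMeasurable g mu0)
    (hC : ∀ᵐ ζ ∂mu0, ‖g ζ‖ ≤ C) {e : ℕ → ℂ → ℂ} (he : ∀ n, Continuous (e n))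
    (he1 : ∀ n ζ, ‖ζ‖ = 1 → ‖e n ζ‖ ≤ 1) {a : ℕ → ℂ} (ha : Summable fun n => ‖a n‖) :
    HasSum (fun n => a n * ∫ ζ, g ζ * e n ζ ∂mu0) (∫ ζ, g ζ * ∑' n, a n * e n ζ ∂mu0) := by
  have hC0 : 0 ≤ C := by
    obtain ⟨ζ, hζ⟩ := hC.exists
    exact (norm_nonneg _).trans hζ
  have hb : ∀ n, ∀ᵐ ζ ∂mu0, ‖a n * (g ζ * e n ζ)‖ ≤ ‖a n‖ * C := by
    intro n
    filter_upwards [hC, ae_norm_eq_one] with ζ h1 h2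
    rw [norm_mul, norm_mul]
    have := mul_le_mul h1 (he1 n ζ h2) (norm_nonneg _) hC0
    rw [mul_one] at this
    gcongr
  have hi : ∀ n, Integrable (fun ζ => a n * (g ζ * e n ζ)) mu0 := fun n =>
    integrable_of_ae_norm_le ((hg.mul (he n).aestronglyMeasurable).const_mul _) (hb n)
  have := hasSum_integral_of_summable_integral_norm hi (by
    refine Summable.of_nonneg_of_le (fun n => integral_nonneg fun _ => norm_nonneg _)
      (fun n => ?_) (ha.mul_right C)
    calc _ ≤ ∫ _, ‖a n‖ * C ∂mu0 := integral_mono_ae (hi n).norm (integrable_const _) (hb n)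
      _ = _ := by simp)
  simp only [integral_const_mul] at this
  have hint : ∫ ζ, g ζ * ∑' n, a n * e n ζ ∂mu0 = ∫ ζ, ∑' n, a n * (g ζ * e n ζ) ∂mu0 := by
    refine integral_congr_ae (.of_forall fun ζ => ?_)
    simp only
    rw [← tsum_mul_left]
    exact tsum_congr fun n => by ring
  rw [hint]
  exact this

lemma aestronglyMeasurable_tsum {a : ℕ → ℂ} (ha : Summable fun n => ‖a n‖) :
    AEStronglyMeasurable (fun ζ => ∑' n, a n * ζ ^ n) mu0 := by
  refine aestronglyMeasurable_of_tendsto_ae atTop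
    (f := fun N ζ => ∑ n ∈ Finset.range N, a n * ζ ^ n)
    (fun N => Continuous.aestronglyMeasurable (by fun_prop)) ?_
  filter_upwards [ae_norm_eq_one] with ζ hζ
  exact (Summable.of_norm (by simpa [hζ] using ha)).hasSum.tendsto_sum_nat

lemma norm_tsum_pow_le {a : ℕ → ℂ} (ha : Summable fun n => ‖a n‖) {ζ : ℂ} (hζ : ‖ζ‖ = 1) :
    ‖∑' n, a n * ζ ^ n‖ ≤ ∑' n, ‖a n‖ := by
  refine tsum_of_norm_bounded (f := fun n => a n * ζ ^ n) ha.hasSum fun n => ?_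
  simp [hζ]

lemma integral_tsum_mul_conj_pow {a : ℕ → ℂ} (ha : Summable fun n => ‖a n‖) (m : ℕ) :
    ∫ ζ, (∑' n, a n * ζ ^ n) * conj ζ ^ m ∂mu0 = a m := by
  have h := hasSum_integral_mul_tsum (g := fun ζ => conj ζ ^ m) (C := 1)
    (Continuous.aestronglyMeasurable (by fun_prop))
    (ae_norm_eq_one.mono fun ζ h => by simp [h]) (e := fun n ζ => ζ ^ n)
    (fun n => by fun_prop) (fun n ζ h => by simp [h]) ha
  simp only [mul_comm (conj _ ^ m), integral_pow_mul_conj_pow, mul_ite, mul_one, mul_zero] at h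
  rw [← h.tsum_eq, tsum_ite_eq]

lemma integral_tsum_mul_pow {a : ℕ → ℂ} (ha : Summable fun n => ‖a n‖) (m : ℕ) :
    ∫ ζ, (∑' n, a n * ζ ^ n) * ζ ^ m ∂mu0 = if m = 0 then a 0 else 0 := by
  have h := hasSum_integral_mul_tsum (g := fun ζ => ζ ^ m) (C := 1)
    (Continuous.aestronglyMeasurable (by fun_prop))
    (ae_norm_eq_one.mono fun ζ h => by simp [h]) (e := fun n ζ => ζ ^ n)
    (fun n => by fun_prop) (fun n ζ h => by simp [h]) ha
  have hz : ∀ n, ∫ ζ, ζ ^ m * ζ ^ n ∂mu0 = if n = 0 then (if m = 0 then 1 else 0) else 0 := by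
    intro n
    have := integral_pow_mul_conj_pow (m + n) 0
    simp only [pow_zero, mul_one, pow_add] at this
    rw [this]
    split_ifs <;> first | rfl | omega
  simp only [hz, mul_ite, mul_one, mul_zero] at h
  simp only [mul_comm _ (_ ^ m)]
  rw [← h.tsum_eq, tsum_ite_eq]

lemma integrable_tsum_mul {a : ℕ → ℂ} (ha : Summable fun n => ‖a n‖) {e : ℂ → ℂ}
    (he : Continuous e) (he1 : ∀ ζ, ‖ζ‖ = 1 → ‖e ζ‖ ≤ 1) :
    Integrable (fun ζ => (∑' n, a n * ζ ^ n) * e ζ) mu0 := by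
  refine integrable_of_ae_norm_le (C := ∑' n, ‖a n‖)
    ((aestronglyMeasurable_tsum ha).mul he.aestronglyMeasurable) ?_
  filter_upwards [ae_norm_eq_one] with ζ hζ
  rw [norm_mul]
  exact (mul_le_of_le_one_right (norm_nonneg _) (he1 ζ hζ)).trans (norm_tsum_pow_le ha hζ)

lemma integral_conj_tsum_mul_conj_pow {a : ℕ → ℂ} (ha : Summable fun n => ‖a n‖) (m : ℕ) :
    ∫ ζ, conj (∑' n, a n * ζ ^ n) * conj ζ ^ m ∂mu0 = if m = 0 then conj (a 0) else 0 := by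
  have h := integral_conj (μ := mu0) (f := fun ζ : ℂ => (∑' n, a n * ζ ^ n) * ζ ^ m)
  rw [integral_tsum_mul_pow ha] at h
  simp only [map_mul, map_pow] at h
  rw [h]
  split_ifs <;> simp

/-- The Fourier coefficients of the real part of a power series. -/
lemma integral_re_tsum_mul_conj_pow {a : ℕ → ℂ} (ha : Summable fun n => ‖a n‖) {m : ℕ}
    (hm : m ≠ 0) :
    ∫ ζ, ((∑' n, a n * ζ ^ n).re : ℂ) * conj ζ ^ m ∂mu0 = a m / 2 := by
  have h1 := integrable_tsum_mul ha (e := fun ζ => conj ζ ^ m) (by fun_prop)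
    (fun ζ h => by simp [h])
  have h2 : Integrable (fun ζ => conj (∑' n, a n * ζ ^ n) * conj ζ ^ m) mu0 := by
    have := integrable_tsum_mul ha (e := fun ζ => ζ ^ m) (by fun_prop) (fun ζ h => by simp [h])
    simpa using (Complex.conjLIE.integrable_comp_iff).2 this
  have : ∀ ζ : ℂ, ((∑' n, a n * ζ ^ n).re : ℂ) * conj ζ ^ m =
      2⁻¹ * ((∑' n, a n * ζ ^ n) * conj ζ ^ m + conj (∑' n, a n * ζ ^ n) * conj ζ ^ m) := by
    intro ζ
    rw [Complex.re_eq_add_conj]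
    ring
  simp only [this]
  rw [integral_const_mul, integral_add h1 h2, integral_tsum_mul_conj_pow ha,
    integral_conj_tsum_mul_conj_pow ha, if_neg hm]
  ring

/-- The Fourier coefficients of the imaginary part of a power series without constant term. -/
lemma integral_im_tsum_mul_conj_pow {a : ℕ → ℂ} (ha : Summable fun n => ‖a n‖) (ha0 : a 0 = 0)
    (m : ℕ) :
    ∫ ζ, ((∑' n, a n * ζ ^ n).im : ℂ) * conj ζ ^ m ∂mu0 = a m / (2 * Complex.I) := by
  have h1 := integrable_tsum_mul ha (e := fun ζ => conj ζ ^ m) (by fun_prop)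
    (fun ζ h => by simp [h])
  have h2 : Integrable (fun ζ => conj (∑' n, a n * ζ ^ n) * conj ζ ^ m) mu0 := by
    have := integrable_tsum_mul ha (e := fun ζ => ζ ^ m) (by fun_prop) (fun ζ h => by simp [h])
    simpa using (Complex.conjLIE.integrable_comp_iff).2 this
  have : ∀ ζ : ℂ, ((∑' n, a n * ζ ^ n).im : ℂ) * conj ζ ^ m = (2 * Complex.I)⁻¹ *
      ((∑' n, a n * ζ ^ n) * conj ζ ^ m - conj (∑' n, a n * ζ ^ n) * conj ζ ^ m) := by
    intro ζ
    rw [Complex.im_eq_sub_conj]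
    ring
  simp only [this]
  rw [integral_const_mul, integral_sub h1 h2, integral_tsum_mul_conj_pow ha,
    integral_conj_tsum_mul_conj_pow ha, ha0, map_zero, ite_self, sub_zero, div_eq_inv_mul]

/-- A power series without constant term whose imaginary part is bounded by `C` on the unit circle
has square integral at most `2 C²`: the integral of the square of the series vanishes, so the real
and the imaginary part have the same square integral. -/
lemma tsum_norm_sq_le {a : ℕ → ℂ} (ha : Summable fun n => ‖a n‖) (ha0 : a 0 = 0) {C : ℝ}
    (hC : ∀ ζ : ℂ, ‖ζ‖ = 1 → |(∑' n, a n * ζ ^ n).im| ≤ C) (s : Finset ℕ) :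
    ∑ n ∈ s, ‖a n‖ ^ 2 ≤ 2 * C ^ 2 := by
  set f : ℂ → ℂ := fun ζ => ∑' n, a n * ζ ^ n with hf
  have hfm : AEStronglyMeasurable f mu0 := aestronglyMeasurable_tsum ha
  have hfb : ∀ᵐ ζ ∂mu0, ‖f ζ‖ ≤ ∑' n, ‖a n‖ := ae_norm_eq_one.mono fun ζ h => norm_tsum_pow_le ha h
  have hsq : ∫ ζ, f ζ * f ζ ∂mu0 = 0 := by
    have h := hasSum_integral_mul_tsum hfm hfb (e := fun n ζ => ζ ^ n)
      (fun n => by fun_prop) (fun n ζ h => by simp [h]) ha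
    simp only [hf, integral_tsum_mul_pow ha, ha0, ite_self, mul_zero] at h
    exact h.unique hasSum_zero
  have hns : HasSum (fun n => ((‖a n‖ ^ 2 : ℝ) : ℂ)) (∫ ζ, f ζ * conj (f ζ) ∂mu0) := by
    have h := hasSum_integral_mul_tsum hfm hfb (e := fun n ζ => conj ζ ^ n)
      (fun n => by fun_prop) (fun n ζ h => by simp [h]) (a := fun n => conj (a n)) (by simpa using ha)
    simp only [hf, integral_tsum_mul_conj_pow ha] at h
    convert h using 3 with n ζ
    · rw [mul_comm, Complex.mul_conj, Complex.normSq_eq_norm_sq]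
    · simp [hf, Complex.conj_tsum]
  have hi1 : Integrable (fun ζ => f ζ * f ζ) mu0 := by
    refine integrable_of_ae_norm_le (C := (∑' n, ‖a n‖) * ∑' n, ‖a n‖) (hfm.mul hfm) ?_
    filter_upwards [hfb] with ζ h
    rw [norm_mul]
    gcongr
  have hre : (∫ ζ, (f ζ * conj (f ζ)) ∂mu0).re ≤ 2 * C ^ 2 := by
    have hi2 : Integrable (fun ζ => f ζ * conj (f ζ)) mu0 := by
      refine integrable_of_ae_norm_le (C := (∑' n, ‖a n‖) * ∑' n, ‖a n‖)
        (hfm.mul (Complex.continuous_conj.comp_aestronglyMeasurable hfm)) ?_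
      filter_upwards [hfb] with ζ h
      rw [norm_mul, Complex.norm_conj]
      gcongr
    have : ∫ ζ, f ζ * conj (f ζ) ∂mu0 = ∫ ζ, (f ζ * conj (f ζ) - f ζ * f ζ) ∂mu0 := by
      rw [integral_sub hi2 hi1, hsq, sub_zero]
    rw [this]
    have h3 := integral_re (𝕜 := ℂ) (hi2.sub hi1)
    simp only [RCLike.re_to_complex, Pi.sub_apply] at h3
    rw [← h3]
    calc _ ≤ ∫ _, 2 * C ^ 2 ∂mu0 := by
          refine integral_mono_ae (hi2.sub hi1).re (integrable_const _) ?_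
          filter_upwards [ae_norm_eq_one] with ζ h1
          have := hC ζ h1
          have h4 : (f ζ).im ^ 2 ≤ C ^ 2 := sq_le_sq.2 (this.trans (le_abs_self _))
          simp
          nlinarith
      _ = _ := by simp
  have hre2 := Complex.hasSum_re hns
  simp only [Complex.ofReal_re] at hre2
  exact (sum_le_hasSum s (fun n _ => by positivity) hre2).trans hre

/-! ### Radial limits at points of differentiability -/

/-- The kernel `2x / (1 - x)²`, evaluated at `x = z ζ̄`, is the derivative of the Herglotz kernel
`(ζ + z) / (ζ - z)` with respect to the angle of `z`, up to the factor `i`. -/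
noncomputable def angularKernel (x : ℂ) : ℂ := 2 * x / (1 - x) ^ 2

lemma norm_mul_conj_lt_one {z ζ : ℂ} (hz : ‖z‖ < 1) (hζ : ‖ζ‖ = 1) : ‖z * conj ζ‖ < 1 := by
  simpa [hζ] using hz

lemma one_sub_ne_zero {x : ℂ} (hx : ‖x‖ < 1) : 1 - x ≠ 0 := by
  intro h
  rw [← sub_eq_zero.1 h] at hx
  simp at hx

lemma im_angularKernel {x : ℂ} (hx : ‖x‖ < 1) :
    (angularKernel x).im = 2 * x.im * (1 - ‖x‖ ^ 2) / ‖1 - x‖ ^ 4 := by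
  have h0 := one_sub_ne_zero hx
  have h2 : ‖1 - x‖ ^ 4 = Complex.normSq ((1 - x) ^ 2) := by
    rw [Complex.normSq_eq_norm_sq, norm_pow]
    ring
  have h3 : ‖x‖ ^ 2 = x.re * x.re + x.im * x.im := by
    rw [← Complex.normSq_eq_norm_sq, Complex.normSq_apply]
  rw [angularKernel, Complex.div_im, h2, h3, ← sub_div]
  congr 1
  simp [pow_two]
  ring

lemma norm_angularKernel_le {z ζ : ℂ} (hz : ‖z‖ < 1) (hζ : ‖ζ‖ = 1) :
    ‖angularKernel (z * conj ζ)‖ ≤ 2 / (1 - ‖z‖) ^ 2 := by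
  have h1 : ‖z * conj ζ‖ = ‖z‖ := by simp [hζ]
  have h2 : 1 - ‖z‖ ≤ ‖1 - z * conj ζ‖ := by
    have := norm_sub_norm_le (1 : ℂ) (z * conj ζ)
    rwa [norm_one, h1] at this
  have h3 : 0 < 1 - ‖z‖ := sub_pos.2 hz
  rw [angularKernel, norm_div, norm_pow, norm_mul, h1, Complex.norm_two]
  gcongr
  linarith

lemma summable_norm_nat_mul_pow {z : ℂ} (hz : ‖z‖ < 1) :
    Summable fun n : ℕ => ‖(n : ℂ) * z ^ n‖ := by
  simpa using summable_norm_pow_mul_geometric_of_norm_lt_one 1 hz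

lemma tsum_two_mul_nat_mul_pow {x : ℂ} (hx : ‖x‖ < 1) :
    ∑' n : ℕ, 2 * ((n : ℂ) * x ^ n) = angularKernel x := by
  rw [tsum_mul_left, tsum_coe_mul_geometric_of_norm_lt_one hx, angularKernel, mul_div_assoc]

lemma aestronglyMeasurable_angularKernel (z : ℂ) :
    AEStronglyMeasurable (fun ζ => angularKernel (z * conj ζ)) mu0 := by
  unfold angularKernel
  have : Measurable fun ζ : ℂ => 2 * (z * conj ζ) / (1 - z * conj ζ) ^ 2 := by
    have hc : Measurable fun ζ : ℂ => conj ζ := Complex.continuous_conj.measurable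
    fun_prop
  exact this.aestronglyMeasurable

/-- The angular derivative of a power series with summable coefficients, as an integral of the real
part of its boundary values. -/
lemma tsum_nat_mul_pow_eq_integral {b : ℕ → ℂ} (hb : Summable fun n => ‖b n‖) {z : ℂ}
    (hz : ‖z‖ < 1) :
    ∑' n : ℕ, n * b n * z ^ n =
      ∫ ζ, ((∑' n, b n * ζ ^ n).re : ℂ) * angularKernel (z * conj ζ) ∂mu0 := by
  have h := hasSum_integral_mul_tsum (g := fun ζ => ((∑' n, b n * ζ ^ n).re : ℂ))
    (C := ∑' n, ‖b n‖)
    (Complex.continuous_ofReal.comp_aestronglyMeasurable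
      (Complex.continuous_re.comp_aestronglyMeasurable (aestronglyMeasurable_tsum hb)))
    (ae_norm_eq_one.mono fun ζ h => by
      rw [Complex.norm_real]
      exact (Complex.abs_re_le_norm _).trans (norm_tsum_pow_le hb h))
    (e := fun n ζ => conj ζ ^ n) (fun n => by fun_prop) (fun n ζ h => by simp [h])
    (a := fun n => 2 * (n * z ^ n)) (by
      simpa only [norm_mul (2 : ℂ)] using (summable_norm_nat_mul_pow hz).mul_left ‖(2 : ℂ)‖)
  have hk : ∫ ζ, ((∑' n, b n * ζ ^ n).re : ℂ) * angularKernel (z * conj ζ) ∂mu0 =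
      ∫ ζ, ((∑' n, b n * ζ ^ n).re : ℂ) * ∑' n : ℕ, 2 * (n * z ^ n) * conj ζ ^ n ∂mu0 := by
    refine integral_congr_ae ?_
    filter_upwards [ae_norm_eq_one] with ζ hζ
    rw [← tsum_two_mul_nat_mul_pow (norm_mul_conj_lt_one hz hζ)]
    congr 1
    exact tsum_congr fun n => by ring
  rw [hk, ← h.tsum_eq]
  refine tsum_congr fun n => ?_
  rcases eq_or_ne n 0 with rfl | hn
  · simp
  · rw [integral_re_tsum_mul_conj_pow hb hn]
    ring

lemma integrable_re_mul_angularKernel {b : ℕ → ℂ} (hb : Summable fun n => ‖b n‖) {z : ℂ}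
    (hz : ‖z‖ < 1) :
    Integrable (fun ζ => ((∑' n, b n * ζ ^ n).re : ℂ) * angularKernel (z * conj ζ)) mu0 := by
  refine integrable_of_ae_norm_le (C := (∑' n, ‖b n‖) * (2 / (1 - ‖z‖) ^ 2))
    ((Complex.continuous_ofReal.comp_aestronglyMeasurable
      (Complex.continuous_re.comp_aestronglyMeasurable (aestronglyMeasurable_tsum hb))).mul
      (aestronglyMeasurable_angularKernel z)) ?_
  filter_upwards [ae_norm_eq_one] with ζ hζ
  rw [norm_mul, Complex.norm_real]
  exact mul_le_mul ((Complex.abs_re_le_norm _).trans (norm_tsum_pow_le hb hζ))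
    (norm_angularKernel_le hz hζ) (norm_nonneg _) (tsum_nonneg fun n => norm_nonneg _)

lemma integrable_re_mul_im_angularKernel {b : ℕ → ℂ} (hb : Summable fun n => ‖b n‖) {z : ℂ}
    (hz : ‖z‖ < 1) :
    Integrable (fun ζ => (∑' n, b n * ζ ^ n).re * (angularKernel (z * conj ζ)).im) mu0 := by
  simpa using (integrable_re_mul_angularKernel hb hz).im

lemma im_tsum_nat_mul_pow_eq_integral {b : ℕ → ℂ} (hb : Summable fun n => ‖b n‖) {z : ℂ}
    (hz : ‖z‖ < 1) :
    (∑' n : ℕ, n * b n * z ^ n).im =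
      ∫ ζ, (∑' n, b n * ζ ^ n).re * (angularKernel (z * conj ζ)).im ∂mu0 := by
  rw [tsum_nat_mul_pow_eq_integral hb hz]
  have := integral_im (𝕜 := ℂ) (integrable_re_mul_angularKernel hb hz)
  simp only [RCLike.im_to_complex, Complex.im_ofReal_mul] at this
  exact this.symm

lemma tsum_pi_single_mul (m : ℕ) (c : ℂ) (w : ℕ → ℂ) :
    ∑' n, (Pi.single m c : ℕ → ℂ) n * w n = c * w m := by
  rw [tsum_eq_single m (fun n hn => by simp [hn])]
  simp

lemma summable_norm_pi_single (m : ℕ) (c : ℂ) :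
    Summable fun n => ‖(Pi.single m c : ℕ → ℂ) n‖ :=
  summable_of_ne_finset_zero (s := {m}) fun n hn => by
    have : n ≠ m := by simpa using hn
    simp [this]

/-- With `ζ = ζ₀ e^{it}`, the function `sin t` and the imaginary part of the kernel have opposite
signs for every `t`, so this is the integral of `|sin t|` against the absolute value of the latter.
It is also the angular derivative of a linear function, which gives its value. -/
lemma integral_im_mul_neg_im_angularKernel {ζ₀ : ℂ} (hζ₀ : ‖ζ₀‖ = 1) {r : ℝ} (hr0 : 0 ≤ r)
    (hr1 : r < 1) :
    Integrable (fun ζ => (ζ * conj ζ₀).im * -(angularKernel (r * ζ₀ * conj ζ)).im) mu0 ∧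
    ∫ ζ, (ζ * conj ζ₀).im * -(angularKernel (r * ζ₀ * conj ζ)).im ∂mu0 = r := by
  have hz : ‖(r : ℂ) * ζ₀‖ < 1 := by simpa [hζ₀, abs_of_nonneg hr0] using hr1
  have hs := summable_norm_pi_single 1 (-Complex.I * conj ζ₀)
  have h := im_tsum_nat_mul_pow_eq_integral hs hz
  have hi := integrable_re_mul_im_angularKernel hs hz
  have hsum : ∀ n : ℕ, (n : ℂ) * (Pi.single 1 (-Complex.I * conj ζ₀) : ℕ → ℂ) n * (r * ζ₀) ^ n =
      (Pi.single 1 (-Complex.I * conj ζ₀) : ℕ → ℂ) n * (n * (r * ζ₀) ^ n) := fun n => by ring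
  have hre : ∀ ζ : ℂ, (-Complex.I * conj ζ₀ * ζ ^ 1).re = (ζ * conj ζ₀).im := fun ζ => by
    simp
    ring
  simp only [hsum, tsum_pi_single_mul, hre] at h hi
  have hval : (-Complex.I * conj ζ₀ * ((1 : ℕ) * (r * ζ₀) ^ 1)).im = -r := by
    have : -Complex.I * conj ζ₀ * ((1 : ℕ) * (r * ζ₀) ^ 1) = -(r * Complex.I) := by
      have h1 : ζ₀ * conj ζ₀ = 1 := by
        rw [Complex.mul_conj, Complex.normSq_eq_norm_sq, hζ₀]
        simp
      push_cast
      linear_combination (-r * Complex.I) * h1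
    rw [this]
    simp
  rw [hval] at h
  simp only [mul_neg]
  refine ⟨hi.neg, ?_⟩
  rw [integral_neg, ← h, neg_neg]

/-- If the real part of the boundary values of a power series vanishes to first order at `ζ₀`, then
the imaginary part of its angular derivative `∑ n b_n z ^ n` tends to `0` radially. -/
lemma tendsto_im_tsum_nat_mul_pow {b : ℕ → ℂ} (hb : Summable fun n => ‖b n‖) {ζ₀ : ℂ}
    (hζ₀ : ‖ζ₀‖ = 1)
    (hsmall : ∀ ε > 0, ∃ C : ℝ, 0 ≤ C ∧ ∀ ζ : ℂ, ‖ζ‖ = 1 →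
      |(∑' n, b n * ζ ^ n).re| ≤ ε * |(ζ * conj ζ₀).im| + C * ‖ζ - ζ₀‖ ^ 4) :
    Tendsto (fun r : ℝ => (∑' n : ℕ, n * b n * (r * ζ₀) ^ n).im) (𝓝[<] 1) (𝓝 0) := by
  have key : ∀ ε > 0, ∃ C : ℝ, ∀ r : ℝ, 0 ≤ r → r < 1 →
      |(∑' n : ℕ, n * b n * (r * ζ₀) ^ n).im| ≤ ε + C * (1 - r ^ 2) := by
    intro ε hε
    obtain ⟨C, hC0, hC⟩ := hsmall ε hε
    refine ⟨32 * C, fun r hr0 hr1 => ?_⟩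
    have hz : ‖(r : ℂ) * ζ₀‖ < 1 := by simpa [hζ₀, abs_of_nonneg hr0] using hr1
    have hr2 : 0 ≤ 1 - r ^ 2 := by nlinarith
    obtain ⟨hi, hint⟩ := integral_im_mul_neg_im_angularKernel hζ₀ hr0 hr1
    rw [im_tsum_nat_mul_pow_eq_integral hb hz, ← Real.norm_eq_abs]
    calc _ ≤ ∫ ζ, (ε * ((ζ * conj ζ₀).im * -(angularKernel (r * ζ₀ * conj ζ)).im) +
            32 * C * (1 - r ^ 2)) ∂mu0 := by
          refine norm_integral_le_of_norm_le ((hi.const_mul ε).add (integrable_const _)) ?_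
          filter_upwards [ae_norm_eq_one] with ζ hζ
          have hx : ‖(r : ℂ) * ζ₀ * conj ζ‖ = r := by simp [hζ, hζ₀, abs_of_nonneg hr0]
          have hxim : ((r : ℂ) * ζ₀ * conj ζ).im = -(r * (ζ * conj ζ₀).im) := by
            simp
            ring
          have hden : ‖1 - (r : ℂ) * ζ₀ * conj ζ‖ = ‖ζ - r * ζ₀‖ := by
            have h1 : ζ * conj ζ = 1 := by
              rw [Complex.mul_conj, Complex.normSq_eq_norm_sq, hζ]
              simp
            have : 1 - (r : ℂ) * ζ₀ * conj ζ = (ζ - r * ζ₀) * conj ζ := by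
              linear_combination -h1
            rw [this, norm_mul, norm_conj_eq_one hζ, mul_one]
          have hdist : ‖ζ - ζ₀‖ ≤ 2 * ‖ζ - r * ζ₀‖ := by
            -- `rζ₀` is at distance `1 - r` from `ζ₀`, and at least that far from the circle
            have h1 : 1 - r ≤ ‖ζ - r * ζ₀‖ := by
              have := norm_sub_norm_le ζ (r * ζ₀)
              rw [hζ, norm_mul, hζ₀, Complex.norm_real, Real.norm_eq_abs,
                abs_of_nonneg hr0, mul_one] at this
              exact this
            have h2 : ‖(r : ℂ) * ζ₀ - ζ₀‖ = 1 - r := by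
              have : (r : ℂ) * ζ₀ - ζ₀ = ((r - 1 : ℝ) : ℂ) * ζ₀ := by push_cast; ring
              rw [this, norm_mul, hζ₀, Complex.norm_real, Real.norm_eq_abs, mul_one,
                abs_of_neg (by linarith)]
              ring
            have h3 := norm_sub_le_norm_sub_add_norm_sub ζ (r * ζ₀) ζ₀
            linarith
          have hpos : 0 < ‖ζ - r * ζ₀‖ := by
            rw [← hden]
            exact norm_pos_iff.2 (one_sub_ne_zero (by rw [hx]; exact hr1))
          rw [im_angularKernel (by rw [hx]; exact hr1), hx, hxim, hden]
          set s := (ζ * conj ζ₀).im with hs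
          have hs1 : |s| ≤ 1 := by
            refine (Complex.abs_im_le_norm _).trans ?_
            simp [hζ, hζ₀]
          set D := ‖ζ - r * ζ₀‖ with hD
          have hD4 : 0 < D ^ 4 := by positivity
          have hK : |2 * -(r * s) * (1 - r ^ 2) / D ^ 4| = 2 * r * (1 - r ^ 2) / D ^ 4 * |s| := by
            rw [abs_div, abs_mul, abs_mul, abs_neg, abs_mul, abs_of_nonneg hr2, abs_of_nonneg hr0,
              abs_of_pos hD4, abs_two]
            ring
          have hC4 : C * ‖ζ - ζ₀‖ ^ 4 * (2 * r * (1 - r ^ 2) / D ^ 4 * |s|) ≤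
              32 * C * (1 - r ^ 2) := by
            calc _ ≤ C * (2 * D) ^ 4 * (2 * 1 * (1 - r ^ 2) / D ^ 4 * 1) := by gcongr
              _ = _ := by field_simp; ring
          rw [Real.norm_eq_abs, abs_mul, hK]
          calc _ ≤ (ε * |s| + C * ‖ζ - ζ₀‖ ^ 4) * (2 * r * (1 - r ^ 2) / D ^ 4 * |s|) := by
                gcongr
                exact hC ζ hζ
            _ = ε * (2 * r * (1 - r ^ 2) / D ^ 4 * (|s| * |s|)) +
                C * ‖ζ - ζ₀‖ ^ 4 * (2 * r * (1 - r ^ 2) / D ^ 4 * |s|) := by ring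
            _ ≤ ε * (2 * r * (1 - r ^ 2) / D ^ 4 * (|s| * |s|)) + 32 * C * (1 - r ^ 2) := by
                gcongr
            _ = _ := by
                rw [abs_mul_abs_self]
                ring
      _ = ε * r + 32 * C * (1 - r ^ 2) := by
          rw [integral_add (hi.const_mul ε) (integrable_const _), integral_const_mul, hint]
          simp
      _ ≤ _ := by
          have : ε * r ≤ ε := mul_le_of_le_one_right hε.le hr1.le
          linarith
  rw [Metric.tendsto_nhds]
  intro ε hε
  obtain ⟨C, hC⟩ := key (ε / 2) (by positivity)
  have hlim : Tendsto (fun r : ℝ => ε / 2 + C * (1 - r ^ 2)) (𝓝[<] 1) (𝓝 (ε / 2)) := by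
    have : Continuous fun r : ℝ => ε / 2 + C * (1 - r ^ 2) := by fun_prop
    simpa using (this.tendsto 1).mono_left nhdsWithin_le_nhds
  filter_upwards [hlim.eventually_lt_const (by linarith : ε / 2 < ε),
    Ioo_mem_nhdsLT (zero_lt_one' ℝ)] with r h1 h2
  rw [dist_zero_right, Real.norm_eq_abs]
  exact (hC r h2.1.le h2.2).trans_lt h1

lemma exp_arg_mul_I {w : ℂ} (hw : ‖w‖ = 1) : Complex.exp (w.arg * Complex.I) = w := by
  have := Complex.norm_mul_exp_arg_mul_I w
  rwa [hw, Complex.ofReal_one, one_mul] at this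

/-- **Fatou's theorem** at a single point: if the real part of the boundary values of `∑ b_n ζ ^ n`
is differentiable with respect to the angle, then the radial limit of the imaginary part of the
angular derivative `∑ n b_n z ^ n` exists, and is minus the derivative. -/
lemma tendsto_im_of_hasDerivAt {b : ℕ → ℂ} (hb : Summable fun n => ‖b n‖) {t₀ D : ℝ}
    (hD : HasDerivAt (fun t : ℝ => (∑' n, b n * Complex.exp (t * Complex.I) ^ n).re) D t₀) :
    Tendsto (fun r : ℝ => (∑' n : ℕ, n * b n * (r * Complex.exp (t₀ * Complex.I)) ^ n).im)
      (𝓝[<] 1) (𝓝 (-D)) := by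
  set ζ₀ := Complex.exp (t₀ * Complex.I) with hζ₀d
  have hζ₀ : ‖ζ₀‖ = 1 := Complex.norm_exp_ofReal_mul_I t₀
  have hζ₀c : ζ₀ * conj ζ₀ = 1 := by
    rw [Complex.mul_conj, Complex.normSq_eq_norm_sq, hζ₀]
    simp
  set Φ : ℂ → ℝ := fun ζ => (∑' n, b n * ζ ^ n).re with hΦ
  -- subtracting `Φ ζ₀ + D sin (t - t₀)` leaves a function that vanishes to first order at `ζ₀`
  set c₀ : ℕ → ℂ := Pi.single 0 (Φ ζ₀ : ℂ) with hc₀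
  set c₁ : ℕ → ℂ := Pi.single 1 (-Complex.I * D * conj ζ₀) with hc₁
  have hs0 := summable_norm_pi_single 0 (Φ ζ₀ : ℂ)
  have hs1 := summable_norm_pi_single 1 (-Complex.I * D * conj ζ₀)
  have hb' : Summable fun n => ‖b n - c₀ n - c₁ n‖ :=
    .of_nonneg_of_le (fun n => norm_nonneg _)
      (fun n => (norm_sub_le _ _).trans (add_le_add (norm_sub_le _ _) le_rfl)) ((hb.add hs0).add hs1)
  have hsumm : ∀ {a : ℕ → ℂ}, (Summable fun n => ‖a n‖) → ∀ {ζ : ℂ}, ‖ζ‖ = 1 →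
      Summable fun n => a n * ζ ^ n := fun ha ζ hζ => Summable.of_norm (by simpa [hζ] using ha)
  have hΨ : ∀ ζ : ℂ, ‖ζ‖ = 1 → (∑' n, (b n - c₀ n - c₁ n) * ζ ^ n).re =
      Φ ζ - Φ ζ₀ - D * (ζ * conj ζ₀).im := by
    intro ζ hζ
    simp only [sub_mul]
    rw [((hsumm hb hζ).sub (hsumm hs0 hζ)).tsum_sub (hsumm hs1 hζ),
      (hsumm hb hζ).tsum_sub (hsumm hs0 hζ), tsum_pi_single_mul, tsum_pi_single_mul]
    simp
    ring
  have hlim := tendsto_im_tsum_nat_mul_pow hb' hζ₀ (by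
    intro ε hε
    -- near `ζ₀`
    have hnear : ∀ᶠ w : ℂ in 𝓝 1, ‖w‖ = 1 → |Φ (ζ₀ * w) - Φ ζ₀ - D * w.im| ≤ ε * |w.im| := by
      have hsin : HasDerivAt (fun t : ℝ => D * Real.sin (t - t₀)) D t₀ := by
        have := (((hasDerivAt_id t₀).sub_const t₀).sin).const_mul D
        simpa using this
      have h1 := (hD.sub hsin).isLittleO
      have h2 := (h1.def (c := ε * (2 / Real.pi)) (by positivity))
      have harg : Tendsto (fun w : ℂ => t₀ + w.arg) (𝓝 1) (𝓝 t₀) := by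
        have : ContinuousAt Complex.arg 1 := Complex.continuousAt_arg (by simp)
        simpa using this.tendsto.const_add t₀
      have hargs : ∀ᶠ w : ℂ in 𝓝 1, |w.arg| ≤ Real.pi / 2 := by
        have : ContinuousAt Complex.arg 1 := Complex.continuousAt_arg (by simp)
        have h3 := this.abs.tendsto
        simp only [Complex.arg_one, abs_zero] at h3
        exact (h3.eventually_lt_const (by positivity)).mono fun _ h => h.le
      filter_upwards [harg.eventually h2, hargs] with w hw hwa hw1
      have hsw : Real.sin w.arg = w.im := by rw [Complex.sin_arg, hw1, div_one]
      have hexp : Complex.exp ((t₀ + w.arg : ℝ) * Complex.I) = ζ₀ * w := by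
        rw [Complex.ofReal_add, add_mul, Complex.exp_add, exp_arg_mul_I hw1]
      have hjordan := Real.mul_abs_le_abs_sin hwa
      rw [hsw] at hjordan
      simp only [Pi.sub_apply, hexp, add_sub_cancel_left, sub_self, Real.sin_zero, mul_zero,
        sub_zero, smul_zero, hsw, Real.norm_eq_abs, ← hζ₀d] at hw
      calc _ = |Φ (ζ₀ * w) - D * w.im - Φ ζ₀| := by congr 1; ring
        _ ≤ ε * (2 / Real.pi) * |w.arg| := hw
        _ ≤ _ := by
          rw [mul_assoc]
          gcongr
    obtain ⟨η, hη, hball⟩ := Metric.eventually_nhds_iff.1 hnear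
    set B := ∑' n, ‖b n - c₀ n - c₁ n‖ with hB
    have hB0 : 0 ≤ B := tsum_nonneg fun n => norm_nonneg _
    refine ⟨B / η ^ 4, by positivity, fun ζ hζ => ?_⟩
    have hw1 : ‖ζ * conj ζ₀‖ = 1 := by simp [hζ, hζ₀]
    have hwζ : ζ₀ * (ζ * conj ζ₀) = ζ := by linear_combination ζ * hζ₀c
    have hdist : ‖ζ * conj ζ₀ - 1‖ = ‖ζ - ζ₀‖ := by
      rw [← hζ₀c, ← sub_mul, norm_mul, norm_conj_eq_one hζ₀, mul_one]
    by_cases hc : ‖ζ - ζ₀‖ < η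
    · have := hball (by rwa [dist_eq_norm, hdist]) hw1
      rw [hwζ] at this
      rw [hΨ ζ hζ]
      exact this.trans (le_add_of_nonneg_right (by positivity))
    · have h1 : η ≤ ‖ζ - ζ₀‖ := not_lt.1 hc
      calc _ ≤ B := (Complex.abs_re_le_norm _).trans (norm_tsum_pow_le hb' hζ)
        _ = B / η ^ 4 * η ^ 4 := by field_simp
        _ ≤ B / η ^ 4 * ‖ζ - ζ₀‖ ^ 4 := by gcongr
        _ ≤ _ := le_add_of_nonneg_left (by positivity))
  have heq : ∀ᶠ r : ℝ in 𝓝[<] 1, (∑' n : ℕ, n * (b n - c₀ n - c₁ n) * (r * ζ₀) ^ n).im - r * D =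
      (∑' n : ℕ, n * b n * (r * ζ₀) ^ n).im := by
    filter_upwards [Ioo_mem_nhdsLT (zero_lt_one' ℝ)] with r hr
    have hz : ‖(r : ℂ) * ζ₀‖ < 1 := by simpa [hζ₀, abs_of_pos hr.1] using hr.2
    have hsu : ∀ {a : ℕ → ℂ}, (Summable fun n => ‖a n‖) →
        Summable fun n : ℕ => a n * (n * (r * ζ₀) ^ n) := by
      intro a ha
      refine Summable.of_norm (.of_nonneg_of_le (fun n => norm_nonneg _) (fun n => ?_)
        ((summable_norm_nat_mul_pow hz).mul_left (∑' n, ‖a n‖)))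
      rw [norm_mul]
      gcongr
      exact ha.le_tsum n fun _ _ => norm_nonneg _
    have h1 : ∑' n : ℕ, n * (b n - c₀ n - c₁ n) * (r * ζ₀) ^ n =
        ∑' n : ℕ, n * b n * (r * ζ₀) ^ n - -Complex.I * D * conj ζ₀ * ((1 : ℕ) * (r * ζ₀) ^ 1) := by
      have : ∀ n : ℕ, n * (b n - c₀ n - c₁ n) * (r * ζ₀) ^ n = b n * (n * (r * ζ₀) ^ n) -
          c₀ n * (n * (r * ζ₀) ^ n) - c₁ n * (n * (r * ζ₀) ^ n) := fun n => by ring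
      simp only [this]
      rw [((hsu hb).sub (hsu hs0)).tsum_sub (hsu hs1), (hsu hb).tsum_sub (hsu hs0),
        tsum_pi_single_mul, tsum_pi_single_mul]
      have : ∀ n : ℕ, b n * (n * (r * ζ₀) ^ n) = n * b n * (r * ζ₀) ^ n := fun n => by ring
      simp only [this]
      simp
    have h2 : -Complex.I * D * conj ζ₀ * ((1 : ℕ) * (r * ζ₀) ^ 1) =
        -((r * D : ℝ) : ℂ) * Complex.I := by
      push_cast
      linear_combination (-r * D * Complex.I) * hζ₀c
    rw [h1, h2]
    simp
  have hr : Tendsto (fun r : ℝ => r * D) (𝓝[<] 1) (𝓝 D) := by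
    have : Continuous fun r : ℝ => r * D := by fun_prop
    simpa using (this.tendsto 1).mono_left nhdsWithin_le_nhds
  simpa using (hlim.sub hr).congr' heq

/-! ### Fatou's theorem for series with bounded imaginary part -/

section

variable {d : ℕ → ℂ}

lemma summable_norm_mul_pow_of_lt_one
    (hd : ∀ r : ℝ, 0 ≤ r → r < 1 → Summable fun n => ‖d n‖ * r ^ n) {r : ℝ} (hr0 : 0 ≤ r)
    (hr1 : r < 1) : Summable fun n => ‖d n * (r : ℂ) ^ n‖ := by
  simpa [abs_of_nonneg hr0] using hd r hr0 hr1

/-- The coefficients are square summable, so those of the angular primitive are summable. -/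
lemma summable_norm_div_nat (hd : ∀ r : ℝ, 0 ≤ r → r < 1 → Summable fun n => ‖d n‖ * r ^ n)
    (hd0 : d 0 = 0) {C : ℝ} (hC : ∀ z : ℂ, ‖z‖ < 1 → |(∑' n, d n * z ^ n).im| ≤ C) :
    Summable fun n : ℕ => ‖d n / n‖ := by
  have hfin : ∀ s : Finset ℕ, ∑ n ∈ s, ‖d n‖ ^ 2 ≤ 2 * C ^ 2 := by
    intro s
    have hev : ∀ᶠ r : ℝ in 𝓝[<] 1, ∑ n ∈ s, ‖d n * (r : ℂ) ^ n‖ ^ 2 ≤ 2 * C ^ 2 := by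
      filter_upwards [Ioo_mem_nhdsLT (zero_lt_one' ℝ)] with r hr
      refine tsum_norm_sq_le (summable_norm_mul_pow_of_lt_one hd hr.1.le hr.2) (by simp [hd0])
        (fun ζ hζ => ?_) s
      have := hC (r * ζ) (by simpa [hζ, abs_of_pos hr.1] using hr.2)
      simpa only [mul_pow, mul_assoc] using this
    have hcont : Continuous fun r : ℝ => ∑ n ∈ s, ‖d n * (r : ℂ) ^ n‖ ^ 2 := by fun_prop
    have := le_of_tendsto ((hcont.tendsto 1).mono_left nhdsWithin_le_nhds) hev
    simpa using this
  have h2 : Summable fun n => ‖d n‖ ^ 2 :=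
    summable_of_sum_le (fun n => by positivity) hfin
  have h3 : Summable fun n : ℕ => 1 / (n : ℝ) ^ 2 := Real.summable_one_div_nat_pow.2 (by norm_num)
  refine Summable.of_nonneg_of_le (fun n => norm_nonneg _) (fun n => ?_) (h2.add h3)
  rw [norm_div, Complex.norm_natCast, div_eq_mul_one_div, ← one_div_pow]
  nlinarith [sq_nonneg (‖d n‖ - 1 / (n : ℝ)), sq_nonneg ‖d n‖, sq_nonneg (1 / (n : ℝ))]

/-- The angular derivative of the real part of `∑ (d_n / n) z ^ n` is minus the imaginary part of
`∑ d_n z ^ n`, so a bound for the latter makes the boundary values Lipschitz. -/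
lemma lipschitzWith_re_tsum (hd : ∀ r : ℝ, 0 ≤ r → r < 1 → Summable fun n => ‖d n‖ * r ^ n)
    (hd0 : d 0 = 0) {C : NNReal} (hC : ∀ z : ℂ, ‖z‖ < 1 → |(∑' n, d n * z ^ n).im| ≤ C) :
    LipschitzWith C fun t : ℝ => (∑' n : ℕ, d n / n * Complex.exp (t * Complex.I) ^ n).re := by
  have hs := summable_norm_div_nat hd hd0 hC
  have hr : ∀ r : ℝ, 0 < r → r < 1 → ∀ t₁ t₂ : ℝ,
      |(∑' n : ℕ, d n / n * (r * Complex.exp (t₁ * Complex.I)) ^ n).re -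
        (∑' n : ℕ, d n / n * (r * Complex.exp (t₂ * Complex.I)) ^ n).re| ≤ C * |t₁ - t₂| := by
    intro r hr0 hr1 t₁ t₂
    have hterm : ∀ (n : ℕ) (t : ℝ), HasDerivAt
        (fun t : ℝ => d n / n * ((r : ℂ) * Complex.exp (t * Complex.I)) ^ n)
        (Complex.I * (d n * (r * Complex.exp (t * Complex.I)) ^ n)) t := by
      intro n t
      have h1 : HasDerivAt (fun t : ℝ => (r : ℂ) * Complex.exp (t * Complex.I))
          (r * (Complex.exp (t * Complex.I) * (1 * Complex.I))) t :=
        (((Complex.ofRealCLM.hasDerivAt (x := t)).mul_const Complex.I).cexp).const_mul _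
      refine ((h1.fun_pow n).const_mul (d n / n)).congr_deriv ?_
      rcases n with _ | n
      · simp [hd0]
      · have : ((n + 1 : ℕ) : ℂ) ≠ 0 := by exact_mod_cast n.succ_ne_zero
        rw [Nat.add_sub_cancel, pow_succ]
        field_simp
    have hder : ∀ t : ℝ, HasDerivAt
        (fun t : ℝ => ∑' n : ℕ, d n / n * ((r : ℂ) * Complex.exp (t * Complex.I)) ^ n)
        (∑' n : ℕ, Complex.I * (d n * (r * Complex.exp (t * Complex.I)) ^ n)) t := by
      refine hasDerivAt_tsum (hd r hr0.le hr1) hterm (fun n t => ?_) (y₀ := 0) ?_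
      · simp [abs_of_pos hr0]
      · refine Summable.of_norm (.of_nonneg_of_le (fun n => norm_nonneg _) (fun n => ?_) hs)
        rw [norm_mul]
        refine mul_le_of_le_one_right (norm_nonneg _) ?_
        simpa [abs_of_pos hr0] using pow_le_one₀ hr0.le hr1.le
    have hre : ∀ t : ℝ, HasDerivAt
        (fun t : ℝ => (∑' n : ℕ, d n / n * ((r : ℂ) * Complex.exp (t * Complex.I)) ^ n).re)
        (-(∑' n : ℕ, d n * (r * Complex.exp (t * Complex.I)) ^ n).im) t := by
      intro t
      have h := Complex.reCLM.hasFDerivAt.comp_hasDerivAt t (hder t)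
      rw [tsum_mul_left] at h
      refine h.congr_deriv ?_
      simp
    have := convex_univ.norm_image_sub_le_of_norm_hasDerivWithin_le
      (fun t _ => (hre t).hasDerivWithinAt) (C := C) (fun t _ => by
        rw [norm_neg]
        refine hC _ ?_
        simpa [abs_of_pos hr0] using hr1) (Set.mem_univ t₂) (Set.mem_univ t₁)
    simpa using this
  have hlim : ∀ t : ℝ, Tendsto
      (fun r : ℝ => (∑' n : ℕ, d n / n * (r * Complex.exp (t * Complex.I)) ^ n).re) (𝓝[<] 1)
      (𝓝 (∑' n : ℕ, d n / n * Complex.exp (t * Complex.I) ^ n).re) := by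
    intro t
    refine (Complex.continuous_re.tendsto _).comp ?_
    refine tendsto_tsum_of_dominated_convergence hs (fun n => ?_) ?_
    · have : Continuous fun r : ℝ => d n / n * (r * Complex.exp (t * Complex.I)) ^ n := by
        fun_prop
      simpa using (this.tendsto 1).mono_left nhdsWithin_le_nhds
    · filter_upwards [Ioo_mem_nhdsLT (zero_lt_one' ℝ)] with r hr n
      rw [norm_mul]
      refine mul_le_of_le_one_right (norm_nonneg _) ?_
      simpa [abs_of_pos hr.1] using pow_le_one₀ hr.1.le hr.2.le
  refine LipschitzWith.of_dist_le_mul fun t₁ t₂ => ?_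
  rw [Real.dist_eq, Real.dist_eq]
  refine le_of_tendsto ((hlim t₁).sub (hlim t₂)).abs ?_
  filter_upwards [Ioo_mem_nhdsLT (zero_lt_one' ℝ)] with r h01
  exact hr r h01.1 h01.2 t₁ t₂

/-- **Fatou's theorem**: the imaginary part of a power series without constant term has radial
limits almost everywhere if it is bounded. -/
lemma ae_exists_tendsto_im (hd : ∀ r : ℝ, 0 ≤ r → r < 1 → Summable fun n => ‖d n‖ * r ^ n)
    (hd0 : d 0 = 0) {C : NNReal} (hC : ∀ z : ℂ, ‖z‖ < 1 → |(∑' n, d n * z ^ n).im| ≤ C) :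
    ∀ᵐ ζ ∂mu0, ∃ x : ℝ,
      Tendsto (fun r : ℝ => (∑' n : ℕ, d n * (r * ζ) ^ n).im) (𝓝[<] 1) (𝓝 x) := by
  refine ae_mu0_of_ae_circleMap ?_
  filter_upwards [(lipschitzWith_re_tsum hd hd0 hC).ae_differentiableAt_real] with t ht
  refine ⟨_, (tendsto_im_of_hasDerivAt (summable_norm_div_nat hd hd0 hC) ht.hasDerivAt).congr
    fun r => ?_⟩
  rw [circleMap_zero, Complex.ofReal_one, one_mul]
  congr 1
  refine tsum_congr fun n => ?_
  rcases eq_or_ne n 0 with rfl | hn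
  · simp [hd0]
  · rw [mul_div_cancel₀ _ (by exact_mod_cast hn)]

/-- The radial boundary values of the imaginary part determine the coefficients. -/
lemma integral_mul_conj_pow_of_tendsto
    (hd : ∀ r : ℝ, 0 ≤ r → r < 1 → Summable fun n => ‖d n‖ * r ^ n)
    (hd0 : d 0 = 0) {C : ℝ} (hC : ∀ z : ℂ, ‖z‖ < 1 → |(∑' n, d n * z ^ n).im| ≤ C) {ξ : ℂ → ℝ}
    (hξ : ∀ᵐ ζ ∂mu0, Tendsto (fun r : ℝ => (∑' n : ℕ, d n * (r * ζ) ^ n).im) (𝓝[<] 1) (𝓝 (ξ ζ)))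
    (m : ℕ) :
    ∫ ζ, (ξ ζ : ℂ) * conj ζ ^ m ∂mu0 = d m / (2 * Complex.I) := by
  have hev : ∀ᶠ r : ℝ in 𝓝[<] 1, r ∈ Set.Ioo (0 : ℝ) 1 := Ioo_mem_nhdsLT (zero_lt_one' ℝ)
  have h1 : Tendsto (fun r : ℝ => ∫ ζ, ((∑' n : ℕ, d n * (r * ζ) ^ n).im : ℂ) * conj ζ ^ m ∂mu0)
      (𝓝[<] 1) (𝓝 (∫ ζ, (ξ ζ : ℂ) * conj ζ ^ m ∂mu0)) := by
    refine tendsto_integral_filter_of_dominated_convergence (fun _ => C) ?_ ?_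
      (integrable_const _) ?_
    · filter_upwards [hev] with r hr
      have := aestronglyMeasurable_tsum (summable_norm_mul_pow_of_lt_one hd hr.1.le hr.2)
      simp only [mul_assoc, ← mul_pow] at this
      exact (Complex.continuous_ofReal.comp_aestronglyMeasurable
        (Complex.continuous_im.comp_aestronglyMeasurable this)).mul
        (Continuous.aestronglyMeasurable (by fun_prop))
    · filter_upwards [hev] with r hr
      filter_upwards [ae_norm_eq_one] with ζ hζ
      have := hC (r * ζ) (by simpa [hζ, abs_of_pos hr.1] using hr.2)
      simpa [hζ] using this
    · filter_upwards [hξ] with ζ hζ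
      exact ((Complex.continuous_ofReal.tendsto _).comp hζ).mul_const _
  have h2 : Tendsto (fun r : ℝ => ∫ ζ, ((∑' n : ℕ, d n * (r * ζ) ^ n).im : ℂ) * conj ζ ^ m ∂mu0)
      (𝓝[<] 1) (𝓝 (d m / (2 * Complex.I))) := by
    have hc : Continuous fun r : ℝ => d m * (r : ℂ) ^ m / (2 * Complex.I) := by fun_prop
    have := (hc.tendsto 1).mono_left (nhdsWithin_le_nhds (s := Set.Iio 1))
    simp only [Complex.ofReal_one, one_pow, mul_one] at this
    refine this.congr' ?_
    filter_upwards [hev] with r hr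
    rw [← integral_im_tsum_mul_conj_pow (summable_norm_mul_pow_of_lt_one hd hr.1.le hr.2)
      (by simp [hd0])]
    simp only [mul_assoc, ← mul_pow]
  exact tendsto_nhds_unique h1 h2

/-- The Schwarz integral formula for the radial boundary values. -/
lemma tsum_eq_integral_herglotz
    (hd : ∀ r : ℝ, 0 ≤ r → r < 1 → Summable fun n => ‖d n‖ * r ^ n)
    (hd0 : d 0 = 0) {C : ℝ} (hC : ∀ z : ℂ, ‖z‖ < 1 → |(∑' n, d n * z ^ n).im| ≤ C) {ξ : ℂ → ℝ}
    (hξm : AEStronglyMeasurable ξ mu0) (hξC : ∀ᵐ ζ ∂mu0, |ξ ζ| ≤ C)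
    (hξ : ∀ᵐ ζ ∂mu0, Tendsto (fun r : ℝ => (∑' n : ℕ, d n * (r * ζ) ^ n).im) (𝓝[<] 1) (𝓝 (ξ ζ)))
    {z : ℂ} (hz : ‖z‖ < 1) :
    ∑' n, d n * z ^ n = Complex.I * ∫ ζ, (ξ ζ : ℂ) * ((ζ + z) / (ζ - z)) ∂mu0 := by
  set c : ℕ → ℂ := fun n => 2 * z ^ n - (Pi.single 0 1 : ℕ → ℂ) n with hc
  have hgeom : Summable fun n => ‖2 * z ^ n‖ := by
    simpa using (summable_geometric_of_lt_one (norm_nonneg z) hz).mul_left 2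
  have hcs : Summable fun n => ‖c n‖ :=
    .of_nonneg_of_le (fun n => norm_nonneg _) (fun n => norm_sub_le _ _)
      (hgeom.add (summable_norm_pi_single 0 1))
  have h := hasSum_integral_mul_tsum (g := fun ζ => (ξ ζ : ℂ)) (C := C)
    (Complex.continuous_ofReal.comp_aestronglyMeasurable hξm)
    (hξC.mono fun ζ h => by simpa using h) (e := fun n ζ => conj ζ ^ n)
    (fun n => by fun_prop) (fun n ζ h => by simp [h]) hcs
  have hker : ∫ ζ, (ξ ζ : ℂ) * ((ζ + z) / (ζ - z)) ∂mu0 =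
      ∫ ζ, (ξ ζ : ℂ) * ∑' n, c n * conj ζ ^ n ∂mu0 := by
    refine integral_congr_ae ?_
    filter_upwards [ae_norm_eq_one] with ζ hζ
    have hx := norm_mul_conj_lt_one hz hζ
    have hgs := (hasSum_geometric_of_norm_lt_one hx).mul_left 2
    have hs1 : Summable fun n => (Pi.single 0 1 : ℕ → ℂ) n * conj ζ ^ n :=
      Summable.of_norm (by simpa [hζ] using summable_norm_pi_single 0 1)
    have hsum : ∑' n, c n * conj ζ ^ n = 2 * (1 - z * conj ζ)⁻¹ - 1 := by
      have : ∀ n, c n * conj ζ ^ n =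
          2 * (z * conj ζ) ^ n - (Pi.single 0 1 : ℕ → ℂ) n * conj ζ ^ n := fun n => by
        rw [hc]; ring
      simp only [this]
      rw [hgs.summable.tsum_sub hs1, hgs.tsum_eq, tsum_pi_single_mul]
      simp
    rw [hsum]
    have h1 : ζ * conj ζ = 1 := by
      rw [Complex.mul_conj, Complex.normSq_eq_norm_sq, hζ]
      simp
    have h2 : ζ - z ≠ 0 := by
      intro h0
      rw [sub_eq_zero.1 h0] at hζ
      exact hz.ne hζ
    have h3 := one_sub_ne_zero hx
    congr 1
    rw [eq_sub_iff_add_eq, ← div_eq_mul_inv]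
    field_simp
    linear_combination (-2 * z) * h1
  rw [hker, ← h.tsum_eq, ← tsum_mul_left]
  refine tsum_congr fun n => ?_
  rw [integral_mul_conj_pow_of_tendsto hd hd0 hC hξ]
  rcases eq_or_ne n 0 with rfl | hn
  · simp [hd0]
  · have : c n = 2 * z ^ n := by simp [hc, hn]
    rw [this]
    field_simp

end

/-! ### The CMV operator is unitary -/

lemma delta_apply (k n : ℤ) : delta k n = if n = k then 1 else 0 := by
  rw [delta, lp.single_apply, Pi.single_apply]

lemma inner_delta_left (k : ℤ) (u : SeqSpace) : inner ℂ (delta k) u = u k := by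
  rw [delta, lp.inner_single_left]
  simp

lemma norm_delta (k : ℤ) : ‖delta k‖ = 1 := by
  rw [delta, lp.norm_single (by norm_num), norm_one]

lemma blockOp_apply (α : ℤ → Complex.UnitDisc) (p : ℤ → Prop) [DecidablePred p] (u : SeqSpace)
    (n : ℤ) : blockOp α p u n = blockFun α p u n := rfl

/-- The sequence of conjugate Verblunsky coefficients, which gives the adjoint matrices `θ_k*`. -/
noncomputable def conjCoeff (α : ℤ → Complex.UnitDisc) (k : ℤ) : Complex.UnitDisc := star (α k)

lemma coe_conjCoeff (α : ℤ → Complex.UnitDisc) (k : ℤ) :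
    (conjCoeff α k : ℂ) = conj (α k : ℂ) := rfl

lemma rho_conjCoeff (α : ℤ → Complex.UnitDisc) (k : ℤ) : rho (conjCoeff α) k = rho α k := by
  rw [rho, rho, coe_conjCoeff, Complex.norm_conj]

lemma rho_mul_rho (α : ℤ → Complex.UnitDisc) (k : ℤ) :
    (rho α k : ℂ) * rho α k = 1 - (α k : ℂ) * conj (α k : ℂ) := by
  have h : 0 ≤ 1 - ‖(α k : ℂ)‖ ^ 2 := by
    nlinarith [(α k).norm_lt_one, norm_nonneg (α k : ℂ)]
  rw [Complex.mul_conj, Complex.normSq_eq_norm_sq, ← Complex.ofReal_mul, rho,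
    Real.mul_self_sqrt h]
  push_cast
  ring

section

variable (α : ℤ → Complex.UnitDisc) (p : ℤ → Prop) [DecidablePred p]

lemma blockOp_delta_of_pos (hp : ∀ n, p (n + 1) ↔ ¬p n) {n : ℤ} (hn : p n) :
    blockOp α p (delta n) =
      conj (α n : ℂ) • delta n + (rho α n : ℂ) • delta (n - 1) := by
  have hn1 : ¬p (n - 1) := by
    have := hp (n - 1)
    rw [sub_add_cancel] at this
    exact this.1 hn
  ext m
  rw [blockOp_apply, blockFun, lp.coeFn_add, lp.coeFn_smul, lp.coeFn_smul]
  simp only [Pi.add_apply, Pi.smul_apply, delta_apply, smul_eq_mul]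
  rcases eq_or_ne m n with rfl | h1
  · have : m ≠ m - 1 := by omega
    simp [hn, theta, this]
  rcases eq_or_ne m (n - 1) with rfl | h2
  · simp [hn1, theta]
  have h3 : m + 1 ≠ n := by omega
  rcases eq_or_ne (m - 1) n with h4 | h4
  · have : ¬p m := by
      have := hp n
      rw [← h4, sub_add_cancel] at this
      intro h
      exact this.1 h (by rwa [h4])
    simp [h1, h2, h3, this]
  · simp [h1, h2, h3, h4]

lemma blockOp_delta_of_neg (hp : ∀ n, p (n + 1) ↔ ¬p n) {n : ℤ} (hn : ¬p n) :
    blockOp α p (delta n) =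
      (-(α (n + 1) : ℂ)) • delta n + (rho α (n + 1) : ℂ) • delta (n + 1) := by
  have hn1 : p (n + 1) := (hp n).2 hn
  ext m
  rw [blockOp_apply, blockFun, lp.coeFn_add, lp.coeFn_smul, lp.coeFn_smul]
  simp only [Pi.add_apply, Pi.smul_apply, delta_apply, smul_eq_mul]
  rcases eq_or_ne m n with rfl | h1
  · simp [hn, theta]
  rcases eq_or_ne m (n + 1) with rfl | h2
  · simp [hn1, theta]
  have h3 : m - 1 ≠ n := by omega
  rcases eq_or_ne (m + 1) n with h4 | h4
  · have : p m := by
      by_contra h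
      exact hn (h4 ▸ (hp m).2 h)
    simp [h1, h2, h3, this]
  · simp [h1, h2, h3, h4]

lemma adjoint_blockOp (hp : ∀ n, p (n + 1) ↔ ¬p n) :
    ContinuousLinearMap.adjoint (blockOp α p) = blockOp (conjCoeff α) p := by
  ext u n
  rw [← inner_delta_left, ContinuousLinearMap.adjoint_inner_right, blockOp_apply, blockFun]
  by_cases hn : p n
  · rw [blockOp_delta_of_pos α p hp hn, inner_add_left, inner_smul_left, inner_smul_left,
      inner_delta_left, inner_delta_left, if_pos hn]
    simp [theta, rho_conjCoeff, coe_conjCoeff]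
    ring
  · rw [blockOp_delta_of_neg α p hp hn, inner_add_left, inner_smul_left, inner_smul_left,
      inner_delta_left, inner_delta_left, if_neg hn]
    simp [theta, rho_conjCoeff, coe_conjCoeff]

lemma blockOp_mul_blockOp_conjCoeff (hp : ∀ n, p (n + 1) ↔ ¬p n) :
    blockOp α p * blockOp (conjCoeff α) p = 1 := by
  ext u n
  rw [mul_apply_eq_comp, one_apply_eq_self, blockOp_apply, blockFun]
  simp only [blockOp_apply, blockFun]
  by_cases hn : p n
  · have hn1 : ¬p (n - 1) := by
      have := hp (n - 1)
      rw [sub_add_cancel] at this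
      exact this.1 hn
    simp only [hn, hn1, if_true, if_false, sub_add_cancel]
    simp [theta, rho_conjCoeff, coe_conjCoeff]
    linear_combination u n * rho_mul_rho α n
  · have hn1 : p (n + 1) := (hp n).2 hn
    simp only [hn, hn1, if_true, if_false, add_sub_cancel_right]
    simp [theta, rho_conjCoeff, coe_conjCoeff]
    linear_combination u n * rho_mul_rho α (n + 1)

lemma conjCoeff_conjCoeff : conjCoeff (conjCoeff α) = α := by
  ext k
  simp [coe_conjCoeff]

lemma even_alternates (n : ℤ) : Even (n + 1) ↔ ¬Even n := Int.even_add_one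

lemma odd_alternates (n : ℤ) : Odd (n + 1) ↔ ¬Odd n := by
  rw [Int.odd_add, Int.not_odd_iff_even]
  simp

lemma opU_mem_unitary : opU α ∈ unitary (SeqSpace →L[ℂ] SeqSpace) := by
  have h : ∀ (p : ℤ → Prop) [DecidablePred p], (∀ n, p (n + 1) ↔ ¬p n) →
      blockOp α p ∈ unitary (SeqSpace →L[ℂ] SeqSpace) := by
    intro p _ hp
    rw [Unitary.mem_iff, ContinuousLinearMap.star_eq_adjoint, adjoint_blockOp α p hp]
    refine ⟨?_, blockOp_mul_blockOp_conjCoeff α p hp⟩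
    have := blockOp_mul_blockOp_conjCoeff (conjCoeff α) p hp
    rwa [conjCoeff_conjCoeff] at this
  exact mul_mem (h Even even_alternates) (h Odd odd_alternates)

/-! ### The resolvent matrix element -/

lemma adjoint_opU_mul_opU : ContinuousLinearMap.adjoint (opU α) * opU α = 1 :=
  (Unitary.mem_iff.1 (opU_mem_unitary α)).1

lemma opU_mul_adjoint_opU : opU α * ContinuousLinearMap.adjoint (opU α) = 1 :=
  (Unitary.mem_iff.1 (opU_mem_unitary α)).2

lemma norm_opU_apply (u : SeqSpace) : ‖opU α u‖ = ‖u‖ :=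
  ContinuousLinearMap.norm_map_of_mem_unitary (opU_mem_unitary α) u

lemma norm_smul_adjoint_opU_lt_one {z : ℂ} (hz : ‖z‖ < 1) :
    ‖z • ContinuousLinearMap.adjoint (opU α)‖ < 1 := by
  rw [norm_smul, LinearIsometryEquiv.norm_map]
  refine (mul_le_of_le_one_right (norm_nonneg _) ?_).trans_lt hz
  exact ContinuousLinearMap.opNorm_le_bound _ zero_le_one fun u => by
    rw [norm_opU_apply, one_mul]

lemma opU_sub_smul_eq (z : ℂ) :
    opU α - z • 1 = (1 - z • ContinuousLinearMap.adjoint (opU α)) * opU α := by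
  rw [sub_mul, one_mul, smul_mul_assoc, adjoint_opU_mul_opU]

lemma isUnit_opU_sub {z : ℂ} (hz : ‖z‖ < 1) : IsUnit (opU α - z • 1) := by
  rw [opU_sub_smul_eq]
  exact (isUnit_one_sub_of_norm_lt_one (norm_smul_adjoint_opU_lt_one α hz)).mul
    (Unitary.toUnits ⟨opU α, opU_mem_unitary α⟩).isUnit

/-- With `v = (U - z)⁻¹ δ_k`, the real part of `M11` is `‖U v‖² - |z|² ‖v‖² = (1 - |z|²) ‖v‖²`. -/
lemma re_M11_pos (k : ℤ) {z : ℂ} (hz : ‖z‖ < 1) : 0 < (M11 α k z).re := by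
  set v := Ring.inverse (opU α - z • 1) (delta k) with hv
  have hδ : opU α v - z • v = delta k := by
    have := congrArg (fun T : SeqSpace →L[ℂ] SeqSpace => T (delta k))
      (Ring.mul_inverse_cancel _ (isUnit_opU_sub α hz))
    simpa [← hv] using this
  have hv0 : v ≠ 0 := by
    intro h0
    have := norm_delta k
    rw [← hδ, h0] at this
    simp at this
  have hM : M11 α k z = inner ℂ (opU α v - z • v) (opU α v + z • v) := by
    rw [hδ, M11]
    simp [← hv]
  have hre : (M11 α k z).re = (1 - ‖z‖ ^ 2) * ‖v‖ ^ 2 := by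
    have hsymm : (inner ℂ (opU α v) (z • v)).re = (inner ℂ (z • v) (opU α v)).re := by
      rw [← inner_conj_symm, Complex.conj_re]
    have h1 : (inner ℂ (opU α v) (opU α v)).re = ‖v‖ ^ 2 := by
      rw [← norm_opU_apply α v]
      exact (norm_sq_eq_re_inner (𝕜 := ℂ) _).symm
    have h2 : (inner ℂ (z • v) (z • v)).re = ‖z‖ ^ 2 * ‖v‖ ^ 2 := by
      rw [← mul_pow, ← norm_smul]
      exact (norm_sq_eq_re_inner (𝕜 := ℂ) _).symm
    rw [hM, inner_sub_left, inner_add_right, inner_add_right, Complex.sub_re, Complex.add_re,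
      Complex.add_re, hsymm, h1, h2]
    ring
  rw [hre]
  have : 0 < 1 - ‖z‖ ^ 2 := by nlinarith [norm_nonneg z]
  have := norm_pos_iff.2 hv0
  positivity

/-- The geometric series of the resolvent. The zeroth coefficient `Mcoeff α k 0` is `2`. -/
lemma hasSum_M11 (k : ℤ) {z : ℂ} (hz : ‖z‖ < 1) :
    HasSum (fun n => Mcoeff α k n * z ^ n) (M11 α k z + 1) := by
  set A := ContinuousLinearMap.adjoint (opU α) with hA
  have hzA : ‖z • A‖ < 1 := norm_smul_adjoint_opU_lt_one α hz
  set S := Ring.inverse (1 - z • A) with hS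
  have hS1 : (1 - z • A) * S = 1 :=
    Ring.mul_inverse_cancel _ (isUnit_one_sub_of_norm_lt_one hzA)
  have hinv : Ring.inverse (opU α - z • 1) = A * S := by
    have h1 : (opU α - z • 1) * (A * S) = 1 := by
      rw [opU_sub_smul_eq, mul_assoc, ← mul_assoc (opU α), opU_mul_adjoint_opU, one_mul, hS1]
    have h2 := Ring.inverse_mul_cancel _ (isUnit_opU_sub α hz)
    calc _ = Ring.inverse (opU α - z • 1) * ((opU α - z • 1) * (A * S)) := by rw [h1, mul_one]
      _ = A * S := by rw [← mul_assoc, h2, one_mul]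
  have hop : (opU α + z • 1) * Ring.inverse (opU α - z • 1) = 2 • S - 1 := by
    rw [hinv, ← mul_assoc, add_mul, opU_mul_adjoint_opU, smul_mul_assoc, one_mul]
    have : (1 : SeqSpace →L[ℂ] SeqSpace) + z • A = 2 • 1 - (1 - z • A) := by
      rw [two_smul]
      abel
    rw [this, sub_mul, hS1, smul_mul_assoc, one_mul]
  have hM : M11 α k z + 1 = 2 * inner ℂ (delta k) (S (delta k)) := by
    rw [M11, hop]
    have h1 : inner ℂ (delta k) (delta k) = (1 : ℂ) := by
      rw [inner_self_eq_norm_sq_to_K, norm_delta]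
      simp
    rw [sub_apply, inner_sub_right, one_apply_eq_self, h1, sub_add_cancel,
      two_smul, add_apply, inner_add_right, two_mul]
  have hgeom : HasSum (fun n : ℕ => (z • A) ^ n) S := by
    rw [hS, ← geom_series_eq_inverse _ hzA]
    exact (summable_geometric_of_norm_lt_one hzA).hasSum
  have h2 := ((hgeom.mapL (ContinuousLinearMap.apply ℂ SeqSpace (delta k))).mapL
    (innerSL ℂ (delta k))).mul_left 2
  have hterm : ∀ n, Mcoeff α k n * z ^ n =
      2 * inner ℂ (delta k) (((z • A) ^ n) (delta k)) := fun n => by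
    rw [Mcoeff, smul_pow, smul_apply, inner_smul_right]
    ring
  simp only [hM, hterm]
  exact h2

/-- The only nonvanishing product in `(V W)_{k,k}` is `V_{k,k} W_{k,k}`. -/
lemma Mcoeff_one (k : ℤ) : Mcoeff α k 1 = -2 * (α k : ℂ) * conj (α (k + 1) : ℂ) := by
  have hU : opU α (delta k) k = -(conj (α k : ℂ) * α (k + 1)) := by
    have hk1 : k + 1 ≠ k := by omega
    have hk2 : k - 1 ≠ k := by omega
    rw [opU, mul_apply_eq_comp, opV, opW, blockOp_apply, blockFun]
    rcases Int.even_or_odd k with hk | hk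
    · have ho : ¬Odd k := Int.not_odd_iff_even.2 hk
      rw [blockOp_delta_of_neg α Odd odd_alternates ho]
      have h1 : k - 1 ≠ k + 1 := by omega
      simp only [lp.coeFn_add, lp.coeFn_smul, Pi.add_apply, Pi.smul_apply, delta_apply, smul_eq_mul]
      simp [hk, theta, h1, hk2]
    · have he : ¬Even k := Int.not_even_iff_odd.2 hk
      rw [blockOp_delta_of_pos α Odd odd_alternates hk]
      have h1 : k + 1 ≠ k - 1 := by omega
      have h2 : k ≠ k - 1 := by omega
      simp only [lp.coeFn_add, lp.coeFn_smul, Pi.add_apply, Pi.smul_apply, delta_apply, smul_eq_mul]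
      simp [he, theta, h1, h2, hk1, mul_comm]
  rw [Mcoeff, pow_one, ContinuousLinearMap.adjoint_inner_right, ← inner_conj_symm,
    inner_delta_left, hU]
  simp
  ring

end

/-! ### The Taylor coefficients of the logarithm -/

lemma powerSeries_coeff_unique {a b : ℕ → ℂ} {g : ℂ → ℂ}
    (ha : ∀ z : ℂ, ‖z‖ < 1 → HasSum (fun n => a n * z ^ n) (g z))
    (hb : ∀ z : ℂ, ‖z‖ < 1 → HasSum (fun n => b n * z ^ n) (g z)) : a = b := by
  have key : ∀ {e : ℕ → ℂ}, (∀ z : ℂ, ‖z‖ < 1 → HasSum (fun n => e n * z ^ n) (g z)) →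
      HasFPowerSeriesAt g (FormalMultilinearSeries.ofScalars ℂ e) 0 := by
    intro e he
    rw [hasFPowerSeriesAt_iff]
    filter_upwards [Metric.ball_mem_nhds (0 : ℂ) one_pos] with z hz
    simpa [mul_comm] using he z (by simpa using hz)
  have := (key ha).eq_formalMultilinearSeries (key hb)
  funext n
  have h := congrArg (fun p => FormalMultilinearSeries.coeff p n) this
  simpa using h

/-- The recursion defining `logCoeff` is the comparison of coefficients in `(log g)' g = g'`. -/
lemma hasSum_logCoeff {g : ℂ → ℂ} {c : ℕ → ℂ} (hg : DifferentiableOn ℂ g (Metric.ball 0 1))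
    (hre : ∀ z : ℂ, ‖z‖ < 1 → 0 < (g z).re)
    (hc : ∀ z : ℂ, ‖z‖ < 1 → HasSum (fun n => c n * z ^ n) (g z + (c 0 - 1))) {z : ℂ}
    (hz : ‖z‖ < 1) : HasSum (fun n => logCoeff c n * z ^ n) (Complex.log (g z)) := by
  have hball : Metric.ball (0 : ℂ) 1 ∈ 𝓝 0 := Metric.ball_mem_nhds 0 one_pos
  set f : ℂ → ℂ := fun z => Complex.log (g z) with hf
  have hslit : ∀ z : ℂ, ‖z‖ < 1 → g z ∈ Complex.slitPlane := fun z hz => Or.inl (hre z hz)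
  have hfd : DifferentiableOn ℂ f (Metric.ball 0 1) :=
    hg.clog fun z hz => hslit z (by simpa using hz)
  have hfact : ∀ n : ℕ, (n.factorial : ℂ) ≠ 0 := fun n => by
    exact_mod_cast n.factorial_ne_zero
  have htaylor : ∀ {h : ℂ → ℂ}, DifferentiableOn ℂ h (Metric.ball 0 1) → ∀ z : ℂ, ‖z‖ < 1 →
      HasSum (fun n => iteratedDeriv n h 0 / n.factorial * z ^ n) (h z) := by
    intro h hh z hz
    have h1 := Complex.hasSum_taylorSeries_on_ball hh (z := z) (by simpa using hz)
    have h2 : ∀ n : ℕ, iteratedDeriv n h 0 / n.factorial * z ^ n =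
        (n.factorial : ℂ)⁻¹ • (z - 0) ^ n • iteratedDeriv n h 0 := fun n => by
      simp only [smul_eq_mul, sub_zero]
      ring
    simp only [h2]
    exact h1
  -- the constant coefficient of `g` is `1`, and the other ones are the `c n`
  have hm : ∀ n, iteratedDeriv n g 0 / n.factorial = if n = 0 then 1 else c n := by
    refine congrFun (powerSeries_coeff_unique (htaylor hg) fun z hz => ?_)
    have h1 : HasSum (fun n => (Pi.single 0 (c 0 - 1) : ℕ → ℂ) n * z ^ n) (c 0 - 1) := by
      have := hasSum_single (f := fun n => (Pi.single 0 (c 0 - 1) : ℕ → ℂ) n * z ^ n) 0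
        (fun n hn => by simp [hn])
      simpa using this
    have h2 : ∀ n, (if n = 0 then 1 else c n) * z ^ n =
        c n * z ^ n - (Pi.single 0 (c 0 - 1) : ℕ → ℂ) n * z ^ n := fun n => by
      rcases eq_or_ne n 0 with rfl | hn
      · simp
      · simp [hn]
    simp only [h2]
    simpa using (hc z hz).sub h1
  have hg0 : g 0 = 1 := by simpa using hm 0
  have hfa : AnalyticAt ℂ f 0 := hfd.analyticAt hball
  have hga : AnalyticAt ℂ g 0 := hg.analyticAt hball
  have hode : deriv g =ᶠ[𝓝 0] deriv f * g := by
    filter_upwards [Metric.isOpen_ball.mem_nhds (Metric.mem_ball_self one_pos)] with w hw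
    have hw1 : ‖w‖ < 1 := by simpa using hw
    have hgw := (hg.differentiableAt (Metric.isOpen_ball.mem_nhds hw)).hasDerivAt
    have hne : g w ≠ 0 := Complex.slitPlane_ne_zero (hslit w hw1)
    rw [Pi.mul_apply, (hgw.clog (hslit w hw1)).deriv]
    field_simp
  have hrec : ∀ n : ℕ, ((n : ℂ) + 1) * (if n + 1 = 0 then 1 else c (n + 1)) =
      ∑ l ∈ Finset.range (n + 1), ((l : ℂ) + 1) * (iteratedDeriv (l + 1) f 0 / (l + 1).factorial) *
        (if n - l = 0 then 1 else c (n - l)) := by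
    intro n
    have h1 := hode.iteratedDeriv_eq n
    rw [iteratedDeriv_mul hfa.deriv.contDiffAt hga.contDiffAt, ← iteratedDeriv_succ'] at h1
    simp only [← hm]
    have h2 : ∀ k : ℕ, ((k : ℂ) + 1) ≠ 0 := fun k => by exact_mod_cast k.succ_ne_zero
    rw [Nat.factorial_succ, h1]
    push_cast
    rw [← mul_div_assoc, mul_div_mul_left _ _ (h2 n), Finset.sum_div]
    refine Finset.sum_congr rfl fun l hl => ?_
    have hln : l ≤ n := Nat.lt_succ_iff.1 (Finset.mem_range.1 hl)
    rw [← iteratedDeriv_succ', Nat.cast_choose ℂ hln, Nat.factorial_succ]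
    have := h2 l
    have := hfact n
    have := hfact l
    have := hfact (n - l)
    push_cast
    field_simp
  have hL : ∀ n, iteratedDeriv n f 0 / n.factorial = logCoeff c n := by
    intro n
    induction n using Nat.strong_induction_on with
    | _ n ih =>
      rcases n with _ | n
      · simp [hf, hg0, logCoeff]
      · have h := hrec n
        have h2 : ((n : ℂ) + 1) ≠ 0 := by exact_mod_cast n.succ_ne_zero
        rw [Finset.sum_range_succ, Nat.sub_self, if_pos rfl, if_neg n.succ_ne_zero, mul_one] at h
        rw [logCoeff, eq_sub_iff_add_eq, ← mul_right_inj' h2, h, mul_add, add_comm]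
        congr 1
        rw [Finset.mul_sum, Finset.sum_range]
        refine Finset.sum_congr rfl fun l _ => ?_
        have hl : n - (l : ℕ) ≠ 0 := by have := l.2; omega
        rw [if_neg hl, ih _ (by omega)]
        field_simp
  simpa only [hL] using htaylor hfd z hz

/-! ### The logarithm of the resolvent matrix element -/

section

variable (α : ℤ → Complex.UnitDisc) (k : ℤ)

lemma differentiableOn_M11 : DifferentiableOn ℂ (M11 α k) (Metric.ball 0 1) := by
  intro z hz
  have hz1 : ‖z‖ < 1 := by simpa using hz
  refine DifferentiableAt.differentiableWithinAt ?_
  have h1 : DifferentiableAt ℂ (fun z : ℂ => opU α + z • (1 : SeqSpace →L[ℂ] SeqSpace)) z := by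
    fun_prop
  have h2 : DifferentiableAt ℂ (fun z : ℂ => opU α - z • (1 : SeqSpace →L[ℂ] SeqSpace)) z := by
    fun_prop
  have h3 : DifferentiableAt ℂ
      (fun z : ℂ => Ring.inverse (opU α - z • (1 : SeqSpace →L[ℂ] SeqSpace))) z :=
    DifferentiableAt.comp z (g := Ring.inverse)
      (differentiableAt_inverse (𝕜 := ℂ) (isUnit_opU_sub α hz1)) h2
  exact (((innerSL ℂ (delta k)).comp
    (ContinuousLinearMap.apply ℂ SeqSpace (delta k))).differentiableAt).comp z (h1.mul h3)

lemma Mcoeff_zero : Mcoeff α k 0 = 2 := by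
  rw [Mcoeff, pow_zero, one_apply_eq_self, inner_self_eq_norm_sq_to_K, norm_delta]
  simp

lemma hasSum_log_M11 {z : ℂ} (hz : ‖z‖ < 1) :
    HasSum (fun n => Lcoeff α k n * z ^ n) (Complex.log (M11 α k z)) := by
  refine hasSum_logCoeff (differentiableOn_M11 α k) (fun z hz => re_M11_pos α k hz)
    (fun z hz => ?_) hz
  convert hasSum_M11 α k hz using 2
  rw [Mcoeff_zero]
  norm_num

lemma Lcoeff_zero : Lcoeff α k 0 = 0 := by rw [Lcoeff, logCoeff]

lemma Lcoeff_one : Lcoeff α k 1 = -2 * (α k : ℂ) * conj (α (k + 1) : ℂ) := by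
  rw [Lcoeff, logCoeff, ← Mcoeff_one]
  simp

lemma summable_norm_Lcoeff (r : ℝ) (hr0 : 0 ≤ r) (hr1 : r < 1) :
    Summable fun n => ‖Lcoeff α k n‖ * r ^ n := by
  have := (hasSum_log_M11 α k (z := r) (by simpa [abs_of_nonneg hr0] using hr1)).summable.norm
  simpa [abs_of_nonneg hr0] using this

lemma abs_im_tsum_Lcoeff_le {z : ℂ} (hz : ‖z‖ < 1) :
    |(∑' n, Lcoeff α k n * z ^ n).im| ≤ Real.pi / 2 := by
  rw [(hasSum_log_M11 α k hz).tsum_eq, Complex.log_im]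
  exact (Complex.abs_arg_lt_pi_div_two_iff.2 (Or.inl (re_M11_pos α k hz))).le

lemma imLogM11_eq {z : ℂ} (hz : ‖z‖ < 1) :
    imLogM11 α k z = (∑' n, Lcoeff α k n * z ^ n).im := by
  rw [imLogM11, (hasSum_log_M11 α k hz).tsum_eq]

lemma imLogM11_eventuallyEq {ζ : ℂ} (hζ : ‖ζ‖ = 1) :
    (fun r : ℝ => imLogM11 α k (r * ζ)) =ᶠ[𝓝[<] 1]
      fun r : ℝ => (∑' n, Lcoeff α k n * (r * ζ) ^ n).im := by
  filter_upwards [Ioo_mem_nhdsLT (zero_lt_one' ℝ)] with r hr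
  exact imLogM11_eq α k (by simpa [hζ, abs_of_pos hr.1] using hr.2)

lemma ae_tendsto_imLogM11 :
    ∀ᵐ ζ ∂mu0, Tendsto (fun r : ℝ => imLogM11 α k (r * ζ)) (𝓝[<] 1) (𝓝 (Xi11 α k ζ)) := by
  filter_upwards [ae_norm_eq_one, ae_exists_tendsto_im (summable_norm_Lcoeff α k) (Lcoeff_zero α k)
    (C := ⟨Real.pi / 2, by positivity⟩) fun z hz => abs_im_tsum_Lcoeff_le α k hz] with ζ hζ h
  obtain ⟨x, hx⟩ := h
  exact tendsto_nhds_limUnder ⟨x, hx.congr' (imLogM11_eventuallyEq α k hζ).symm⟩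

lemma ae_tendsto_im_tsum :
    ∀ᵐ ζ ∂mu0, Tendsto (fun r : ℝ => (∑' n, Lcoeff α k n * (r * ζ) ^ n).im) (𝓝[<] 1)
      (𝓝 (Xi11 α k ζ)) := by
  filter_upwards [ae_norm_eq_one, ae_tendsto_imLogM11 α k] with ζ hζ h
  exact h.congr' (imLogM11_eventuallyEq α k hζ)

lemma ae_abs_Xi11_le : ∀ᵐ ζ ∂mu0, |Xi11 α k ζ| ≤ Real.pi / 2 := by
  filter_upwards [ae_norm_eq_one, ae_tendsto_im_tsum α k] with ζ hζ h
  refine le_of_tendsto h.abs ?_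
  filter_upwards [Ioo_mem_nhdsLT (zero_lt_one' ℝ)] with r hr
  exact abs_im_tsum_Lcoeff_le α k (by simpa [hζ, abs_of_pos hr.1] using hr.2)

lemma aestronglyMeasurable_Xi11 : AEStronglyMeasurable (Xi11 α k) mu0 := by
  -- along the radii `1 - 1 / (n + 2)`, which lie in `(0, 1)`
  have hr : Tendsto (fun n : ℕ => 1 - 1 / ((n : ℝ) + 2)) atTop (𝓝[<] 1) := by
    refine tendsto_nhdsWithin_iff.2 ⟨?_, .of_forall fun n => ?_⟩
    · have : Tendsto (fun n : ℕ => 1 / ((n : ℝ) + 2)) atTop (𝓝 0) :=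
        tendsto_const_nhds.div_atTop
          (tendsto_natCast_atTop_atTop.atTop_add tendsto_const_nhds)
      simpa using this.const_sub 1
    · have : 0 < 1 / ((n : ℝ) + 2) := by positivity
      rw [Set.mem_Iio]
      linarith
  refine aestronglyMeasurable_of_tendsto_ae atTop
    (f := fun (n : ℕ) ζ => (∑' m, Lcoeff α k m * ((1 - 1 / ((n : ℝ) + 2) : ℝ) * ζ) ^ m).im)
    (fun n => ?_) ((ae_tendsto_im_tsum α k).mono fun ζ h => h.comp hr)
  have h1 : 1 / ((n : ℝ) + 2) ≤ 1 := by
    rw [div_le_one (by positivity)]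
    linarith [Nat.cast_nonneg (α := ℝ) n]
  have h2 : 0 < 1 / ((n : ℝ) + 2) := by positivity
  have := aestronglyMeasurable_tsum (summable_norm_mul_pow_of_lt_one (summable_norm_Lcoeff α k)
    (r := 1 - 1 / ((n : ℝ) + 2)) (by linarith) (by linarith))
  simp only [mul_assoc, ← mul_pow] at this
  exact Complex.continuous_im.comp_aestronglyMeasurable this

lemma Lcoeff_eq_integral (j : ℕ) :
    Lcoeff α k j = 2 * Complex.I * ∫ ζ, (Xi11 α k ζ : ℂ) * conj ζ ^ j ∂mu0 := by
  rw [integral_mul_conj_pow_of_tendsto (summable_norm_Lcoeff α k) (Lcoeff_zero α k)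
    (fun z hz => abs_im_tsum_Lcoeff_le α k hz) (ae_tendsto_im_tsum α k)]
  field_simp

end

end CMV

theorem theorem2p2 (α : ℤ → Complex.UnitDisc) (k : ℤ) :
    -- on the unit disk, `M11` is given by an honest resolvent and has positive real part
    (∀ z : ℂ, ‖z‖ < 1 → IsUnit (CMV.opU α - z • 1) ∧ 0 < (CMV.M11 α k z).re) ∧
    -- the `L_j` are the Taylor coefficients of `ln M11` at `0`
    (∀ᶠ z : ℂ in 𝓝 0,
      HasSum (fun j : ℕ => CMV.Lcoeff α k (j + 1) * z ^ (j + 1)) (Complex.log (CMV.M11 α k z))) ∧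
    -- `Xi11` is the boundary phase of the exponential Herglotz representation of `M11`
    (∀ᵐ ζ ∂CMV.mu0,
      Tendsto (fun r : ℝ => CMV.imLogM11 α k (r * ζ)) (𝓝[<] 1) (𝓝 (CMV.Xi11 α k ζ))) ∧
    (∀ᵐ ζ ∂CMV.mu0, CMV.Xi11 α k ζ ∈ Set.Icc (-(Real.pi / 2)) (Real.pi / 2)) ∧
    Integrable (CMV.Xi11 α k) CMV.mu0 ∧
    (∀ z : ℂ, ‖z‖ < 1 →
      Complex.log (CMV.M11 α k z) =
        Complex.I * ∫ ζ, (CMV.Xi11 α k ζ : ℂ) * ((ζ + z) / (ζ - z)) ∂CMV.mu0) ∧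
    -- the trace formulas
    (∀ j : ℕ, 1 ≤ j →
      CMV.Lcoeff α k j =
        2 * Complex.I * ∫ ζ, (CMV.Xi11 α k ζ : ℂ) * (conj ζ) ^ j ∂CMV.mu0) ∧
    CMV.Lcoeff α k 1 = -2 * (α k : ℂ) * conj (α (k + 1) : ℂ) ∧
    -2 * (α k : ℂ) * conj (α (k + 1) : ℂ) =
      2 * Complex.I * ∫ ζ, (CMV.Xi11 α k ζ : ℂ) * conj ζ ∂CMV.mu0 := by
  refine ⟨fun z hz => ⟨CMV.isUnit_opU_sub α hz, CMV.re_M11_pos α k hz⟩, ?_,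
    CMV.ae_tendsto_imLogM11 α k, (CMV.ae_abs_Xi11_le α k).mono fun ζ h => abs_le.1 h,
    (integrable_const (Real.pi / 2)).mono' (CMV.aestronglyMeasurable_Xi11 α k)
      (CMV.ae_abs_Xi11_le α k), fun z hz => ?_, fun j _ => CMV.Lcoeff_eq_integral α k j,
    CMV.Lcoeff_one α k, ?_⟩
  · filter_upwards [Metric.ball_mem_nhds (0 : ℂ) one_pos] with z hz
    have h := CMV.hasSum_log_M11 α k (z := z) (by simpa using hz)
    rw [hasSum_nat_add_iff' 1 |>.symm] at h
    simpa [CMV.Lcoeff_zero] using h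
  · rw [← (CMV.hasSum_log_M11 α k hz).tsum_eq]
    exact CMV.tsum_eq_integral_herglotz (CMV.summable_norm_Lcoeff α k) (CMV.Lcoeff_zero α k)
      (fun z hz => CMV.abs_im_tsum_Lcoeff_le α k hz) (CMV.aestronglyMeasurable_Xi11 α k)
      (CMV.ae_abs_Xi11_le α k) (CMV.ae_tendsto_im_tsum α k) hz
  · rw [← CMV.Lcoeff_one, CMV.Lcoeff_eq_integral]
    simp only [pow_one]
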